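/- Let $n\ge 1$ and let $(\sigma_{ij})$ be a non-degenerate real symmetric $n\times n$ matrix. On $\mathbb{R}^{4n}$, with coordinates $x^1,\dots,x^{4n}$, consider the semi-Riemannian metric $$g = 2\sum_{a=1}^{2n} dx^a\,dx^{a+2n} + \Bigl(\sum_{i,j=1}^{n}\sigma_{ij}\,d\bigl(x^i x^{j+n}\bigr)\Bigr)^2 .$$ Then $(\mathbb{R}^{4n},g)$ is a symmetric space, i.e. for every point $p$ there is an isometry $s_p$ fixing $p$ with differential $-\mathrm{id}$ at $p$. Let $G$ be its transvection group, i.e. the group generated by all products $s_p\circ s_q$ with $p,q\in\mathbb{R}^{4n}$. Then: 1. $G$ is $3$-step nilpotent (nilpotent of class exactly $3$) and $2$-step solvable (solvable of derived length exactly $2$). 2. For every $p\in\mathbb{R}^{4n}$ the isotropy group $G_p$, the stabilizer of $p$ in $G$, is abelian and unipotent: the differential at $p$ of each element of $G_p$ is a unipotent endomorphism of $T_p\mathbb{R}^{4n}$. 3. For every $p\in\mathbb{R}^{4n}$ the isotropy algebra at $p$, i.e. the set of all $A\in\mathfrak{gl}(T_p\mathbb{R}^{4n})$ such that for every $t\in\mathbb{R}$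 the endomorphism $\exp(tA)$ is the differential at $p$ of an element of $G_p$, is an abelian Lie subalgebra consisting of nilpotent endomorphisms, and it has dimension $n(2n-1)$. -/

import Mathlib

open scoped ContDiff

-- The Lie bracket on endomorphisms is the commutator.
attribute [local instance] LieRing.ofAssociativeRing

/-- A smooth semi-Riemannian metric on a real normed space `E`, regarded as a manifold whose
tangent spaces are all identified with `E` by translation. Only the topology and the linear
structure of `E` play a role, the norm does not. -/
structure SemiRiemannianMetric (E : Type*) [NormedAddCommGroup E] [NormedSpace ℝ E] where
  /-- the symmetric bilinear form on the tangent space at each point -/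
  form : E → E →L[ℝ] E →L[ℝ] ℝ
  contDiff_form : ContDiff ℝ ∞ form
  symm : ∀ x u v, form x u v = form x v u
  nondegenerate : ∀ x u, (∀ v, form x u v = 0) → u = 0

namespace SemiRiemannianMetric

variable {E : Type*} [NormedAddCommGroup E] [NormedSpace ℝ E]

/-- `φ` is an isometry of `(E, g)`: a diffeomorphism of `E` with `φ^* g = g`. -/
def IsIsometry (g : SemiRiemannianMetric E) (φ : Equiv.Perm E) : Prop :=
  ContDiff ℝ ∞ φ ∧ ContDiff ℝ ∞ φ.symm ∧
    ∀ x u v, g.form (φ x) (fderiv ℝ φ x u) (fderiv ℝ φ x v) = g.form x u v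

/-- `s` is a symmetry of `(E, g)` at the point `p`: an isometry that fixes `p` and whose
differential at `p` is `-id`. -/
def IsSymmetryAt (g : SemiRiemannianMetric E) (p : E) (s : Equiv.Perm E) : Prop :=
  g.IsIsometry s ∧ s p = p ∧ fderiv ℝ s p = -ContinuousLinearMap.id ℝ E

/-- `(E, g)` is a (globally) symmetric space: there is a symmetry at every point. -/
def IsSymmetricSpace (g : SemiRiemannianMetric E) : Prop :=
  ∀ p, ∃ s, g.IsSymmetryAt p s

/-- The transvection group of `(E, g)`: the group of diffeomorphisms generated by the products
of two symmetries at points of `E`. -/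
def transvectionGroup (g : SemiRiemannianMetric E) : Subgroup (Equiv.Perm E) :=
  Subgroup.closure {φ | ∃ p q s t, g.IsSymmetryAt p s ∧ g.IsSymmetryAt q t ∧ φ = s * t}

/-- The isotropy group at `p`: the stabilizer of `p` in the transvection group. -/
def isotropyGroup (g : SemiRiemannianMetric E) (p : E) : Subgroup (Equiv.Perm E) :=
  g.transvectionGroup ⊓ MulAction.stabilizer (Equiv.Perm E) p

/-- The linear isotropy group at `p`: the differentials at `p` of the elements of the isotropy
group, i.e. the image of the isotropy representation on the tangent space at `p`. -/
def linearIsotropy (g : SemiRiemannianMetric E) (p : E) : Set (E →L[ℝ] E) :=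
  {A | ∃ φ ∈ g.isotropyGroup p, fderiv ℝ φ p = A}

/-- `𝔥` is the isotropy algebra at `p`: the Lie algebra of the linear isotropy group at `p`,
consisting of the generators of its one-parameter subgroups. -/
def IsIsotropyAlgebra (g : SemiRiemannianMetric E) (p : E)
    (𝔥 : LieSubalgebra ℝ (E →L[ℝ] E)) : Prop :=
  ∀ A : E →L[ℝ] E, A ∈ 𝔥 ↔ ∀ t : ℝ, NormedSpace.exp (t • A) ∈ g.linearIsotropy p

end SemiRiemannianMetric

/-- `ℝ^{4n}`, with the coordinates in four blocks of length `n`: for `i : Fin n`, the numbers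
`x 0 i`, `x 1 i`, `x 2 i`, `x 3 i` are `x^i`, `x^{i+n}`, `x^{i+2n}`, `x^{i+3n}`. -/
abbrev R4 (n : ℕ) : Type := Fin 4 → Fin n → ℝ

/-- The quadratic function `∑_{i,j} σ_{ij} x^i x^{j+n}` on `ℝ^{4n}`. -/
def sigmaFun {n : ℕ} (σ : Matrix (Fin n) (Fin n) ℝ) (x : R4 n) : ℝ :=
  ∑ i, ∑ j, σ i j * (x 0 i * x 1 j)

/-- The `i`-th coordinate of the `k`-th block, as a continuous linear form. -/
def coordCLM (n : ℕ) (k : Fin 4) (i : Fin n) : R4 n →L[ℝ] ℝ :=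
  (ContinuousLinearMap.proj i : (Fin n → ℝ) →L[ℝ] ℝ).comp
    (ContinuousLinearMap.proj k : R4 n →L[ℝ] (Fin n → ℝ))

theorem coordCLM_apply (n : ℕ) (k : Fin 4) (i : Fin n) (x : R4 n) :
    coordCLM n k i x = x k i := rfl

theorem contDiff_sigmaFun {n : ℕ} (σ : Matrix (Fin n) (Fin n) ℝ) :
    ContDiff ℝ ∞ (sigmaFun σ) := by
  unfold sigmaFun
  fun_prop

theorem fderiv_sigmaFun {n : ℕ} (σ : Matrix (Fin n) (Fin n) ℝ) (x u : R4 n) :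
    fderiv ℝ (sigmaFun σ) x u = ∑ i, ∑ j, σ i j * (u 0 i * x 1 j + x 0 i * u 1 j) := by
  have h : HasFDerivAt (sigmaFun σ) (∑ i, ∑ j, σ i j •
      (x 0 i • coordCLM n 1 j + x 1 j • coordCLM n 0 i)) x := by
    unfold sigmaFun
    refine HasFDerivAt.fun_sum fun i _ => HasFDerivAt.fun_sum fun j _ => ?_
    exact (((coordCLM n 0 i).hasFDerivAt (x := x)).mul
      ((coordCLM n 1 j).hasFDerivAt (x := x))).const_mul (σ i j)
  rw [h.fderiv]
  simp only [_root_.sum_apply, _root_.smul_apply,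
    _root_.add_apply, coordCLM_apply, smul_eq_mul]
  refine Finset.sum_congr rfl fun i _ => Finset.sum_congr rfl fun j _ => ?_
  ring

/-- The flat bilinear form `2 ∑_{a ≤ 2n} dx^a dx^{a+2n}`, the products of one-forms being
symmetric products. -/
noncomputable def flatForm (n : ℕ) : R4 n →L[ℝ] R4 n →L[ℝ] ℝ :=
  ∑ i, ((coordCLM n 0 i).smulRight (coordCLM n 2 i) + (coordCLM n 2 i).smulRight (coordCLM n 0 i)
    + (coordCLM n 1 i).smulRight (coordCLM n 3 i) + (coordCLM n 3 i).smulRight (coordCLM n 1 i))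

theorem flatForm_apply (n : ℕ) (u v : R4 n) :
    flatForm n u v = ∑ i, (u 0 i * v 2 i + u 2 i * v 0 i + u 1 i * v 3 i + u 3 i * v 1 i) := by
  simp [flatForm, coordCLM_apply]

/-- The bilinear form `2 ∑_a dx^a dx^{a+2n} + (∑_{i,j} σ_{ij} d(x^i x^{j+n}))^2` at `x`. -/
noncomputable def sigmaForm {n : ℕ} (σ : Matrix (Fin n) (Fin n) ℝ) (x : R4 n) :
    R4 n →L[ℝ] R4 n →L[ℝ] ℝ :=
  flatForm n + (fderiv ℝ (sigmaFun σ) x).smulRight (fderiv ℝ (sigmaFun σ) x)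

theorem sigmaForm_apply {n : ℕ} (σ : Matrix (Fin n) (Fin n) ℝ) (x u v : R4 n) :
    sigmaForm σ x u v =
      ∑ i, (u 0 i * v 2 i + u 2 i * v 0 i + u 1 i * v 3 i + u 3 i * v 1 i)
        + fderiv ℝ (sigmaFun σ) x u * fderiv ℝ (sigmaFun σ) x v := by
  simp [sigmaForm, flatForm_apply]

/-- The semi-Riemannian metric
`2 ∑_{a=1}^{2n} dx^a dx^{a+2n} + (∑_{i,j} σ_{ij} d(x^i x^{j+n}))^2` on `ℝ^{4n}`. -/
noncomputable def sigmaMetric {n : ℕ} (σ : Matrix (Fin n) (Fin n) ℝ) :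
    SemiRiemannianMetric (R4 n) where
  form := sigmaForm σ
  contDiff_form := by
    unfold sigmaForm
    have h : ContDiff ℝ ∞ (fderiv ℝ (sigmaFun σ)) :=
      (contDiff_sigmaFun σ).fderiv_right (by simp)
    exact contDiff_const.add (h.smulRight h)
  symm x u v := by
    rw [sigmaForm_apply, sigmaForm_apply, mul_comm (fderiv ℝ (sigmaFun σ) x u)]
    congr 1
    exact Finset.sum_congr rfl fun i _ => by ring
  nondegenerate x u hu := by
    have h0 : ∀ i, u 0 i = 0 := fun i => by
      have := hu (Pi.single 2 (Pi.single i 1))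
      simpa [sigmaForm_apply, fderiv_sigmaFun, Pi.single_apply] using this
    have h1 : ∀ i, u 1 i = 0 := fun i => by
      have := hu (Pi.single 3 (Pi.single i 1))
      simpa [sigmaForm_apply, fderiv_sigmaFun, Pi.single_apply] using this
    have hF : fderiv ℝ (sigmaFun σ) x u = 0 := by simp [fderiv_sigmaFun, h0, h1]
    have h2 : ∀ i, u 2 i = 0 := fun i => by
      have := hu (Pi.single 0 (Pi.single i 1))
      simpa [sigmaForm_apply, hF, h0, h1, Pi.single_apply] using this
    have h3 : ∀ i, u 3 i = 0 := fun i => by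
      have := hu (Pi.single 1 (Pi.single i 1))
      simpa [sigmaForm_apply, hF, h0, h1, Pi.single_apply] using this
    funext k i
    fin_cases k
    · exact h0 i
    · exact h1 i
    · exact h2 i
    · exact h3 i

/-! Write `⟨,⟩` for the flat form, `J = sigmaEnd σ` and `B(x, y) = ⟨Jx, y⟩`. Then `J² = 0`, and as
`σ` is invertible, `ker J = im J` is the span of the last two blocks. The metric is `⟨u, v⟩ + B(x,
u) B(x, v)`, and its geodesic equation is `c'' = -B(c', c') J c`. Hence `J c` is affine, `B(c', c')`
is constant and geodesics are explicit cubics. From any point they reach every other point, so an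
isometry is determined by its 1-jet at one point (`eq_of_isIsometry_sigmaMetric`) and the symmetry
at `p` must be `x ↦ 2p - x - B(x - p, x - p) J p`.

Products of symmetries have the form `sigmaMap σ a A`, with `A` in the space `sigmaSkew σ` of skew
maps into `ker J`. Such `A` kill `ker J`, so any two have product zero. Modulo `ker J` the group
acts by translations. Commutators therefore have the form `x ↦ x + b + A x` with `b ∈ ker J`; these
commute with one another, their commutators with the group are translations along `ker J`, and those
are central. This bounds the class by 3 and the derived length by 2; the double commutator of the
maps with parameters `a`, `b`, `c` is translation by `sigmaWedge σ a b c`, which can be nonzero.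

The stabilizer of `p` consists of the maps `x ↦ x + A (x - p)`. Every `A` in `sigmaSkew σ` occurs,
because wedges arise from products of transvections and span that space
(`sigmaSkew_le_sigmaSkewTransvection`). Skew maps from the `2n`-dimensional quotient by `ker J` to
its dual form a copy of `so(2n)`, of dimension `n(2n-1)`. -/

/-! ### Linear algebra of `J` and `B`. -/

/-- The endomorphism of `ℝ^{4n}` that represents the second derivative of `sigmaFun σ` with
respect to the flat form. -/
noncomputable def sigmaEnd {n : ℕ} (σ : Matrix (Fin n) (Fin n) ℝ) : R4 n →L[ℝ] R4 n :=
  LinearMap.toContinuousLinearMap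
    { toFun := fun x => ![0, 0, σ.mulVec (x 1), σ.transpose.mulVec (x 0)]
      map_add' := fun x y => by
        funext k
        fin_cases k <;> simp [Matrix.mulVec_add]
      map_smul' := fun c x => by
        funext k
        fin_cases k <;> simp [Matrix.mulVec_smul] }

theorem sigmaEnd_apply {n : ℕ} (σ : Matrix (Fin n) (Fin n) ℝ) (x : R4 n) :
    sigmaEnd σ x = ![0, 0, σ.mulVec (x 1), σ.transpose.mulVec (x 0)] := rfl

theorem sigmaEnd_sigmaEnd {n : ℕ} (σ : Matrix (Fin n) (Fin n) ℝ) (x : R4 n) :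
    sigmaEnd σ (sigmaEnd σ x) = 0 := by
  funext k
  fin_cases k <;> simp [sigmaEnd_apply]

/-- The second derivative of `sigmaFun σ`. -/
noncomputable def sigmaBilin {n : ℕ} (σ : Matrix (Fin n) (Fin n) ℝ) : R4 n →L[ℝ] R4 n →L[ℝ] ℝ :=
  (flatForm n).comp (sigmaEnd σ)

theorem flatForm_comm {n : ℕ} (x y : R4 n) : flatForm n x y = flatForm n y x := by
  rw [flatForm_apply, flatForm_apply]
  exact Finset.sum_congr rfl fun i _ => by ring

theorem eq_zero_of_flatForm {n : ℕ} {x : R4 n} (h : ∀ y, flatForm n x y = 0) : x = 0 := by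
  funext k i
  have h0 := h (Pi.single 0 (Pi.single i 1))
  have h1 := h (Pi.single 1 (Pi.single i 1))
  have h2 := h (Pi.single 2 (Pi.single i 1))
  have h3 := h (Pi.single 3 (Pi.single i 1))
  simp [flatForm_apply, Pi.single_apply] at h0 h1 h2 h3
  fin_cases k <;> simp [*]

theorem flatForm_sigmaEnd_left {n : ℕ} (σ : Matrix (Fin n) (Fin n) ℝ) (x y : R4 n) :
    flatForm n (sigmaEnd σ x) y = sigmaBilin σ x y := rfl

theorem sigmaBilin_apply {n : ℕ} (σ : Matrix (Fin n) (Fin n) ℝ) (x y : R4 n) :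
    sigmaBilin σ x y = ∑ i, ∑ j, σ i j * (x 0 i * y 1 j + y 0 i * x 1 j) := by
  rw [← flatForm_sigmaEnd_left, flatForm_apply]
  simp [sigmaEnd_apply, mul_add, Finset.sum_add_distrib, Matrix.mulVec, dotProduct, Finset.sum_mul]
  rw [add_comm]
  congr 1
  · rw [Finset.sum_comm]
    exact Finset.sum_congr rfl fun i _ => Finset.sum_congr rfl fun j _ => by ring
  · exact Finset.sum_congr rfl fun i _ => Finset.sum_congr rfl fun j _ => by ring

theorem sigmaBilin_comm {n : ℕ} (σ : Matrix (Fin n) (Fin n) ℝ) (x y : R4 n) :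
    sigmaBilin σ x y = sigmaBilin σ y x := by
  simp only [sigmaBilin_apply]
  exact Finset.sum_congr rfl fun i _ => Finset.sum_congr rfl fun j _ => by ring

theorem flatForm_sigmaEnd_right {n : ℕ} (σ : Matrix (Fin n) (Fin n) ℝ) (x y : R4 n) :
    flatForm n x (sigmaEnd σ y) = sigmaBilin σ x y := by
  rw [flatForm_comm, flatForm_sigmaEnd_left, sigmaBilin_comm]

theorem sigmaBilin_eq_zero_left {n : ℕ} {σ : Matrix (Fin n) (Fin n) ℝ} {x : R4 n}
    (hx : sigmaEnd σ x = 0) (y : R4 n) : sigmaBilin σ x y = 0 := by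
  rw [← flatForm_sigmaEnd_left, hx, map_zero, _root_.zero_apply]

theorem sigmaBilin_eq_zero_right {n : ℕ} {σ : Matrix (Fin n) (Fin n) ℝ} {y : R4 n}
    (hy : sigmaEnd σ y = 0) (x : R4 n) : sigmaBilin σ x y = 0 := by
  rw [sigmaBilin_comm, sigmaBilin_eq_zero_left hy]

theorem sigmaBilin_sigmaEnd_left {n : ℕ} (σ : Matrix (Fin n) (Fin n) ℝ) (x y : R4 n) :
    sigmaBilin σ (sigmaEnd σ x) y = 0 :=
  sigmaBilin_eq_zero_left (sigmaEnd_sigmaEnd σ x) y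

theorem sigmaBilin_sigmaEnd_right {n : ℕ} (σ : Matrix (Fin n) (Fin n) ℝ) (x y : R4 n) :
    sigmaBilin σ x (sigmaEnd σ y) = 0 :=
  sigmaBilin_eq_zero_right (sigmaEnd_sigmaEnd σ y) x

/-- `B` descends to the quotient by `ker J`; later computations use this to drop all terms in `ker
J` from its arguments. -/
theorem sigmaBilin_congr {n : ℕ} {σ : Matrix (Fin n) (Fin n) ℝ} {x x' y y' : R4 n}
    (hx : sigmaEnd σ x = sigmaEnd σ x') (hy : sigmaEnd σ y = sigmaEnd σ y') :
    sigmaBilin σ x y = sigmaBilin σ x' y' := by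
  rw [← flatForm_sigmaEnd_left, hx, flatForm_sigmaEnd_left, ← flatForm_sigmaEnd_right, hy,
    flatForm_sigmaEnd_right]

theorem fderiv_sigmaFun_eq {n : ℕ} (σ : Matrix (Fin n) (Fin n) ℝ) :
    fderiv ℝ (sigmaFun σ) = sigmaBilin σ := by
  funext x
  ext u
  rw [fderiv_sigmaFun, sigmaBilin_apply]
  exact Finset.sum_congr rfl fun i _ => Finset.sum_congr rfl fun j _ => by ring

theorem sigmaMetric_form_apply {n : ℕ} (σ : Matrix (Fin n) (Fin n) ℝ) (x u v : R4 n) :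
    (sigmaMetric σ).form x u v = flatForm n u v + sigmaBilin σ x u * sigmaBilin σ x v := by
  change sigmaForm σ x u v = _
  rw [sigmaForm_apply, ← flatForm_apply, fderiv_sigmaFun_eq]

theorem exists_sigmaEnd_eq {n : ℕ} {σ : Matrix (Fin n) (Fin n) ℝ} (hdet : σ.det ≠ 0) {x : R4 n}
    (h0 : x 0 = 0) (h1 : x 1 = 0) : ∃ z, sigmaEnd σ z = x := by
  have hu : IsUnit σ.det := hdet.isUnit
  have hu' : IsUnit σ.transpose.det := by rwa [Matrix.det_transpose]
  refine ⟨![σ.transpose⁻¹.mulVec (x 3), σ⁻¹.mulVec (x 2), 0, 0], ?_⟩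
  funext k
  rw [sigmaEnd_apply]
  fin_cases k <;>
    simp [h0, h1, Matrix.mulVec_mulVec, Matrix.mul_nonsing_inv _ hu, Matrix.mul_nonsing_inv _ hu']

theorem sigmaEnd_eq_zero_iff {n : ℕ} {σ : Matrix (Fin n) (Fin n) ℝ} (hdet : σ.det ≠ 0) {x : R4 n} :
    sigmaEnd σ x = 0 ↔ x 0 = 0 ∧ x 1 = 0 := by
  refine ⟨fun h => ⟨?_, ?_⟩, fun h => ?_⟩
  · have h3 := congrFun h 3
    rw [sigmaEnd_apply] at h3
    exact Matrix.eq_zero_of_mulVec_eq_zero (by rwa [Matrix.det_transpose]) (by simpa using h3)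
  · have h2 := congrFun h 2
    rw [sigmaEnd_apply] at h2
    exact Matrix.eq_zero_of_mulVec_eq_zero hdet (by simpa using h2)
  · funext k
    rw [sigmaEnd_apply]
    fin_cases k <;> simp [h.1, h.2]

theorem exists_sigmaEnd_eq_of_sigmaEnd_eq_zero {n : ℕ} {σ : Matrix (Fin n) (Fin n) ℝ}
    (hdet : σ.det ≠ 0) {x : R4 n} (hx : sigmaEnd σ x = 0) : ∃ z, sigmaEnd σ z = x :=
  exists_sigmaEnd_eq hdet ((sigmaEnd_eq_zero_iff hdet).1 hx).1 ((sigmaEnd_eq_zero_iff hdet).1 hx).2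

/-! ### Isometries preserve geodesics. -/

namespace SemiRiemannianMetric

section Geodesic

variable {E : Type*} [NormedAddCommGroup E] [NormedSpace ℝ E]

/-- The curve `c` is a geodesic of `(E, g)`: it satisfies the Euler-Lagrange equation of the
energy `g(c', c') / 2`. -/
def IsGeodesic (g : SemiRiemannianMetric E) (c : ℝ → E) : Prop :=
  ContDiff ℝ ∞ c ∧ ∀ t w,
    2 * (g.form (c t) (deriv (deriv c) t) w + fderiv ℝ g.form (c t) (deriv c t) (deriv c t) w)
      = fderiv ℝ g.form (c t) w (deriv c t) (deriv c t)

/-- Differentiate `φ^* g = g`, evaluated on constant fields `v` and `w`, in the direction `u`. -/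
theorem IsIsometry.fderiv_form {g : SemiRiemannianMetric E} {φ : Equiv.Perm E}
    (hφ : g.IsIsometry φ) (x u v w : E) :
    fderiv ℝ g.form (φ x) (fderiv ℝ φ x u) (fderiv ℝ φ x v) (fderiv ℝ φ x w)
      + g.form (φ x) (fderiv ℝ (fderiv ℝ φ) x u v) (fderiv ℝ φ x w)
      + g.form (φ x) (fderiv ℝ φ x v) (fderiv ℝ (fderiv ℝ φ) x u w)
      = fderiv ℝ g.form x u v w := by
  have hg : Differentiable ℝ g.form := g.contDiff_form.differentiable (by simp)
  have h1 : HasFDerivAt φ (fderiv ℝ φ x) x :=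
    (hφ.1.differentiable (by simp) x).hasFDerivAt
  have h2 : HasFDerivAt (fderiv ℝ φ) (fderiv ℝ (fderiv ℝ φ) x) x :=
    ((hφ.1.fderiv_right (m := ∞) (by simp)).differentiable (by simp) x).hasFDerivAt
  have h0 : HasFDerivAt (g.form ∘ φ) ((fderiv ℝ g.form (φ x)).comp (fderiv ℝ φ x)) x :=
    HasFDerivAt.comp (G := E →L[ℝ] E →L[ℝ] ℝ) x (hg (φ x)).hasFDerivAt h1
  have hv : HasFDerivAt (fun y => fderiv ℝ φ y v) _ x := h2.clm_apply (hasFDerivAt_const v x)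
  have hw : HasFDerivAt (fun y => fderiv ℝ φ y w) _ x := h2.clm_apply (hasFDerivAt_const w x)
  have h3 := (h0.clm_apply hv).clm_apply hw
  have h4 := ((hg x).hasFDerivAt.clm_apply (hasFDerivAt_const v x)).clm_apply
    (hasFDerivAt_const w x)
  have h5 : (fun y => (g.form ∘ φ) y (fderiv ℝ φ y v) (fderiv ℝ φ y w))
      = fun y => g.form y v w := funext fun y => hφ.2.2 y v w
  rw [h5] at h3
  have h6 := DFunLike.congr_fun (h3.unique h4) u
  simp at h6
  linarith

theorem IsIsometry.surjective_fderiv {g : SemiRiemannianMetric E} {φ : Equiv.Perm E}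
    (hφ : g.IsIsometry φ) (x : E) : Function.Surjective (fderiv ℝ φ x) := by
  intro w
  have h1 : HasFDerivAt φ (fderiv ℝ φ (φ.symm (φ x))) (φ.symm (φ x)) :=
    (hφ.1.differentiable (by simp) _).hasFDerivAt
  have h2 : HasFDerivAt φ.symm (fderiv ℝ φ.symm (φ x)) (φ x) :=
    (hφ.2.1.differentiable (by simp) _).hasFDerivAt
  have h3 := h1.comp (φ x) h2
  rw [Equiv.self_comp_symm, Equiv.symm_apply_apply] at h3
  exact ⟨fderiv ℝ φ.symm (φ x) w, DFunLike.congr_fun (h3.unique (hasFDerivAt_id _)) w⟩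

theorem IsIsometry.comp_isGeodesic {g : SemiRiemannianMetric E} {φ : Equiv.Perm E}
    (hφ : g.IsIsometry φ) {c : ℝ → E} (hc : g.IsGeodesic c) : g.IsGeodesic (φ ∘ c) := by
  refine ⟨hφ.1.comp hc.1, fun t w => ?_⟩
  have hc1 : ContDiff ℝ ∞ (deriv c) := (contDiff_infty_iff_deriv.1 hc.1).2
  have h1 : ∀ x, HasFDerivAt φ (fderiv ℝ φ x) x := fun x =>
    (hφ.1.differentiable (by simp) x).hasFDerivAt
  have h2 : ∀ x, HasFDerivAt (fderiv ℝ φ) (fderiv ℝ (fderiv ℝ φ) x) x := fun x =>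
    ((hφ.1.fderiv_right (m := ∞) (by simp)).differentiable (by simp) x).hasFDerivAt
  have h3 : ∀ t, HasDerivAt c (deriv c t) t := fun t =>
    (hc.1.differentiable (by simp) t).hasDerivAt
  have h4 : HasDerivAt (deriv c) (deriv (deriv c) t) t :=
    (hc1.differentiable (by simp) t).hasDerivAt
  have e1 : deriv (φ ∘ c) = fun t => fderiv ℝ φ (c t) (deriv c t) :=
    funext fun t => ((h1 (c t)).comp_hasDerivAt t (h3 t)).deriv
  have e2 : deriv (deriv (φ ∘ c)) t = fderiv ℝ (fderiv ℝ φ) (c t) (deriv c t) (deriv c t)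
      + fderiv ℝ φ (c t) (deriv (deriv c) t) := by
    rw [e1]
    exact (((h2 (c t)).comp_hasDerivAt t (h3 t)).clm_apply h4).deriv
  obtain ⟨w, rfl⟩ := hφ.surjective_fderiv (c t) w
  rw [e2, e1]
  simp only [Function.comp_apply, map_add, _root_.add_apply]
  have hsymm : fderiv ℝ (fderiv ℝ φ) (c t) w (deriv c t)
      = fderiv ℝ (fderiv ℝ φ) (c t) (deriv c t) w :=
    (hφ.1.contDiffAt.isSymmSndFDerivAt (by simpa using ENat.LEInfty.out)).eq _ _
  -- In `2 * k1 - k2` the terms pairing `dφ(c')` with `d²φ(c', w)` cancel; what remains of `d²φ` is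
  -- the extra summand of `e2`.
  have k1 := hφ.fderiv_form (c t) (deriv c t) (deriv c t) w
  have k2 := hφ.fderiv_form (c t) w (deriv c t) (deriv c t)
  have k3 := hc.2 t w
  have k4 := hφ.2.2 (c t) (deriv (deriv c) t) w
  rw [hsymm, g.symm (φ (c t)) (fderiv ℝ (fderiv ℝ φ) (c t) (deriv c t) w)] at k2
  linarith

end Geodesic

end SemiRiemannianMetric

/-! ### Explicit geodesics and rigidity of isometries. -/

section SigmaGeodesic

variable {n : ℕ} (σ : Matrix (Fin n) (Fin n) ℝ)

theorem fderiv_sigmaMetric_form (x u v w : R4 n) :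
    fderiv ℝ (sigmaMetric σ).form x u v w
      = sigmaBilin σ u v * sigmaBilin σ x w + sigmaBilin σ x v * sigmaBilin σ u w := by
  have h1 := (((sigmaMetric σ).contDiff_form.differentiable (by simp) x).hasFDerivAt.clm_apply
    (hasFDerivAt_const v x)).clm_apply (hasFDerivAt_const w x)
  have h2 := (((sigmaBilin σ).hasFDerivAt (x := x).clm_apply (hasFDerivAt_const v x)).mul
    ((sigmaBilin σ).hasFDerivAt (x := x).clm_apply (hasFDerivAt_const w x))).const_add
      (flatForm n v w)
  have h3 : (fun y => (sigmaMetric σ).form y v w)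
      = fun y => flatForm n v w + sigmaBilin σ y v * sigmaBilin σ y w :=
    funext fun y => sigmaMetric_form_apply σ y v w
  rw [h3] at h1
  have h4 := DFunLike.congr_fun (h1.unique h2) u
  simp at h4
  linarith

theorem isGeodesic_sigmaMetric_iff {c : ℝ → R4 n} :
    (sigmaMetric σ).IsGeodesic c ↔ ContDiff ℝ ∞ c ∧
      ∀ t, deriv (deriv c) t = -sigmaBilin σ (deriv c t) (deriv c t) • sigmaEnd σ (c t) := by
  refine and_congr_right fun _ => forall_congr' fun t => ?_
  simp only [sigmaMetric_form_apply, fderiv_sigmaMetric_form]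
  constructor
  -- Testing against `im J` gives `J c'' = 0`, which removes `B(c, c'')` from the equation; then
  -- test against all vectors.
  · intro h
    have h1 : sigmaEnd σ (deriv (deriv c) t) = 0 := by
      refine eq_zero_of_flatForm fun y => ?_
      have := h (sigmaEnd σ y)
      simp only [sigmaBilin_sigmaEnd_right, sigmaBilin_sigmaEnd_left,
        flatForm_sigmaEnd_right] at this
      rw [flatForm_sigmaEnd_left]
      linarith
    have h2 : deriv (deriv c) t
        + sigmaBilin σ (deriv c t) (deriv c t) • sigmaEnd σ (c t) = 0 := by
      refine eq_zero_of_flatForm fun y => ?_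
      have := h y
      rw [sigmaBilin_eq_zero_right h1, sigmaBilin_comm σ y] at this
      simp only [map_add, map_smul, _root_.add_apply, _root_.smul_apply, smul_eq_mul,
        flatForm_sigmaEnd_left]
      linarith
    rw [neg_smul]
    exact eq_neg_of_add_eq_zero_left h2
  · intro h w
    rw [h]
    simp only [map_smul, _root_.smul_apply, smul_eq_mul, flatForm_sigmaEnd_left,
      sigmaBilin_sigmaEnd_right, sigmaBilin_comm σ w]
    ring

variable {σ}

theorem eq_of_deriv_eq {F : Type*} [NormedAddCommGroup F] [NormedSpace ℝ F] {c d : ℝ → F}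
    (hc : Differentiable ℝ c) (hd : Differentiable ℝ d) (h : deriv c = deriv d)
    (h0 : c 0 = d 0) : c = d := by
  funext t
  have := is_const_of_deriv_eq_zero (hc.sub hd)
    (fun t => by rw [deriv_sub (hc t) (hd t), h, sub_self]) t 0
  simpa [h0, sub_eq_zero] using this

theorem eq_of_deriv_deriv_eq {F : Type*} [NormedAddCommGroup F] [NormedSpace ℝ F]
    {c d : ℝ → F} (hc : ContDiff ℝ ∞ c) (hd : ContDiff ℝ ∞ d)
    (h : deriv (deriv c) = deriv (deriv d)) (h1 : deriv c 0 = deriv d 0) (h0 : c 0 = d 0) :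
    c = d :=
  eq_of_deriv_eq (hc.differentiable (by simp)) (hd.differentiable (by simp))
    (eq_of_deriv_eq ((contDiff_infty_iff_deriv.1 hc).2.differentiable (by simp))
      ((contDiff_infty_iff_deriv.1 hd).2.differentiable (by simp)) h h1) h0

theorem deriv_continuousLinearMap_comp {F G : Type*} [NormedAddCommGroup F] [NormedSpace ℝ F]
    [NormedAddCommGroup G] [NormedSpace ℝ G] (L : F →L[ℝ] G) {c : ℝ → F}
    (hc : ContDiff ℝ ∞ c) : deriv (L ∘ c) = L ∘ deriv c :=
  funext fun t =>
    (L.hasFDerivAt.comp_hasDerivAt t (hc.differentiable (by simp) t).hasDerivAt).deriv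

theorem SemiRiemannianMetric.IsGeodesic.sigmaEnd_deriv_deriv {c : ℝ → R4 n} (hc : (sigmaMetric σ).IsGeodesic c) :
    deriv (deriv (sigmaEnd σ ∘ c)) = 0 := by
  rw [deriv_continuousLinearMap_comp _ hc.1, deriv_continuousLinearMap_comp _ (contDiff_infty_iff_deriv.1 hc.1).2]
  funext t
  simp [((isGeodesic_sigmaMetric_iff σ).1 hc).2 t, sigmaEnd_sigmaEnd]

/-- No ODE theorem is needed: `J ∘ c` has zero second derivative, so initial data fix it, and the
right-hand side of the geodesic equation depends on `c` only through `J ∘ c`. -/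
theorem eq_of_isGeodesic_sigmaMetric {c d : ℝ → R4 n} (hc : (sigmaMetric σ).IsGeodesic c)
    (hd : (sigmaMetric σ).IsGeodesic d) (h0 : c 0 = d 0) (h1 : deriv c 0 = deriv d 0) : c = d := by
  have hJ : sigmaEnd σ ∘ c = sigmaEnd σ ∘ d := by
    refine eq_of_deriv_deriv_eq ((sigmaEnd σ).contDiff.comp hc.1)
      ((sigmaEnd σ).contDiff.comp hd.1) ?_ ?_ ?_
    · rw [hc.sigmaEnd_deriv_deriv, hd.sigmaEnd_deriv_deriv]
    · rw [deriv_continuousLinearMap_comp _ hc.1, deriv_continuousLinearMap_comp _ hd.1]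
      simp [h1]
    · simp [h0]
  have hJ' : sigmaEnd σ ∘ deriv c = sigmaEnd σ ∘ deriv d := by
    rw [← deriv_continuousLinearMap_comp _ hc.1, ← deriv_continuousLinearMap_comp _ hd.1, hJ]
  refine eq_of_deriv_deriv_eq hc.1 hd.1 (funext fun t => ?_) h1 h0
  rw [((isGeodesic_sigmaMetric_iff σ).1 hc).2 t, ((isGeodesic_sigmaMetric_iff σ).1 hd).2 t,
    sigmaBilin_congr (congrFun hJ' t) (congrFun hJ' t), show sigmaEnd σ (c t) = sigmaEnd σ (d t)
    from congrFun hJ t]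

variable (σ) in
/-- The geodesic of `sigmaMetric σ` with initial point `p` and initial velocity `v`. -/
noncomputable def sigmaGeodesic (p v : R4 n) (t : ℝ) : R4 n :=
  p + t • v - sigmaBilin σ v v • ((t ^ 2 / 2) • sigmaEnd σ p + (t ^ 3 / 6) • sigmaEnd σ v)

theorem hasDerivAt_sigmaGeodesic (p v : R4 n) (t : ℝ) :
    HasDerivAt (sigmaGeodesic σ p v)
      (v - sigmaBilin σ v v • (t • sigmaEnd σ p + (t ^ 2 / 2) • sigmaEnd σ v)) t := by
  have h2 : HasDerivAt (fun t : ℝ => t ^ 2 / 2) t t := 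
    ((hasDerivAt_pow 2 t).div_const 2).congr_deriv (by simp)
  have h3 : HasDerivAt (fun t : ℝ => t ^ 3 / 6) (t ^ 2 / 2) t := 
    ((hasDerivAt_pow 3 t).div_const 6).congr_deriv (by simp; ring)
  exact ((((hasDerivAt_id t).smul_const v).const_add p).sub
    (((h2.smul_const (sigmaEnd σ p)).add (h3.smul_const (sigmaEnd σ v))).const_smul
      (sigmaBilin σ v v))).congr_deriv (by rw [one_smul])

theorem isGeodesic_sigmaGeodesic (p v : R4 n) :
    (sigmaMetric σ).IsGeodesic (sigmaGeodesic σ p v) := by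
  rw [isGeodesic_sigmaMetric_iff]
  have e1 : deriv (sigmaGeodesic σ p v) =
      fun t => v - sigmaBilin σ v v • (t • sigmaEnd σ p + (t ^ 2 / 2) • sigmaEnd σ v) :=
    funext fun t => (hasDerivAt_sigmaGeodesic p v t).deriv
  refine ⟨by unfold sigmaGeodesic; fun_prop, fun t => ?_⟩
  have h2 : HasDerivAt (fun t : ℝ => t ^ 2 / 2) t t := 
    ((hasDerivAt_pow 2 t).div_const 2).congr_deriv (by simp)
  have h3 := ((((hasDerivAt_id t).smul_const (sigmaEnd σ p)).add
    (h2.smul_const (sigmaEnd σ v))).const_smul (sigmaBilin σ v v)).const_sub v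
  rw [e1]
  refine h3.deriv.trans ?_
  simp [sigmaGeodesic, sigmaEnd_sigmaEnd, sigmaBilin_sigmaEnd_left, sigmaBilin_sigmaEnd_right]
  module

theorem exists_sigmaGeodesic_one_eq (p x : R4 n) : ∃ v, sigmaGeodesic σ p v 1 = x := by
  -- The correction lies in `im J = ker J`, so `v` and `x - p` have the same image under `J` and the
  -- same value of `B`; the cubic at time 1 can thus be solved for `v`.
  refine ⟨x - p + sigmaBilin σ (x - p) (x - p) •
    ((1 / 2 : ℝ) • sigmaEnd σ p + (1 / 6 : ℝ) • sigmaEnd σ (x - p)), ?_⟩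
  generalize hy : x - p = y
  obtain rfl : x = p + y := by rw [← hy]; abel
  simp [sigmaGeodesic, sigmaEnd_sigmaEnd, sigmaBilin_sigmaEnd_left, sigmaBilin_sigmaEnd_right]
  module

theorem eq_of_isIsometry_sigmaMetric {φ ψ : Equiv.Perm (R4 n)}
    (hφ : (sigmaMetric σ).IsIsometry φ) (hψ : (sigmaMetric σ).IsIsometry ψ) {p : R4 n}
    (h0 : φ p = ψ p) (h1 : fderiv ℝ φ p = fderiv ℝ ψ p) : φ = ψ := by
  refine Equiv.ext fun x => ?_
  obtain ⟨v, rfl⟩ := exists_sigmaGeodesic_one_eq (σ := σ) p x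
  have hγ0 : sigmaGeodesic σ p v 0 = p := by simp [sigmaGeodesic]
  have hd : ∀ χ : Equiv.Perm (R4 n), (sigmaMetric σ).IsIsometry χ →
      deriv (χ ∘ sigmaGeodesic σ p v) 0 = fderiv ℝ χ p v := by
    intro χ hχ
    have h : HasFDerivAt χ (fderiv ℝ χ (sigmaGeodesic σ p v 0)) (sigmaGeodesic σ p v 0) :=
      (hχ.1.differentiable (by simp) _).hasFDerivAt
    rw [(h.comp_hasDerivAt 0 (hasDerivAt_sigmaGeodesic p v 0)).deriv, hγ0]
    simp
  have := eq_of_isGeodesic_sigmaMetric (hφ.comp_isGeodesic (isGeodesic_sigmaGeodesic p v))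
    (hψ.comp_isGeodesic (isGeodesic_sigmaGeodesic p v)) (by simp [hγ0, h0])
    (by rw [hd φ hφ, hd ψ hψ, h1])
  exact congrFun this 1

end SigmaGeodesic

/-! ### The symmetries. -/

section SigmaSymmetry

variable {n : ℕ} (σ : Matrix (Fin n) (Fin n) ℝ)

/-- Modulo `ker J` the map sends `x - p` to its negative, so `B` takes the same value both times and
the two corrections cancel. -/
theorem involutive_sigmaSymmetry (p : R4 n) : Function.Involutive
    fun x => (2 : ℝ) • p - x - sigmaBilin σ (x - p) (x - p) • sigmaEnd σ p := by
  intro x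
  have h : sigmaEnd σ ((2 : ℝ) • p - x - sigmaBilin σ (x - p) (x - p) • sigmaEnd σ p - p)
      = sigmaEnd σ (-(x - p)) := by
    simp only [map_sub, map_smul, map_neg, sigmaEnd_sigmaEnd]
    module
  simp only [sigmaBilin_congr h h, map_neg, _root_.neg_apply, neg_neg]
  module

/-- The symmetry of `sigmaMetric σ` at the point `p`. -/
noncomputable def sigmaSymmetry (p : R4 n) : Equiv.Perm (R4 n) :=
  (involutive_sigmaSymmetry σ p).toPerm

theorem sigmaSymmetry_apply (p x : R4 n) : sigmaSymmetry σ p x =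
    (2 : ℝ) • p - x - sigmaBilin σ (x - p) (x - p) • sigmaEnd σ p := rfl

theorem sigmaSymmetry_symm (p : R4 n) : (sigmaSymmetry σ p).symm = sigmaSymmetry σ p :=
  (involutive_sigmaSymmetry σ p).toPerm_symm

theorem contDiff_sigmaSymmetry (p : R4 n) : ContDiff ℝ ∞ (sigmaSymmetry σ p) := by
  have : ⇑(sigmaSymmetry σ p) = fun x =>
    (2 : ℝ) • p - x - sigmaBilin σ (x - p) (x - p) • sigmaEnd σ p := rfl
  rw [this]
  fun_prop

theorem fderiv_sigmaSymmetry (p x u : R4 n) : fderiv ℝ (sigmaSymmetry σ p) x u =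
    -u - (2 * sigmaBilin σ (x - p) u) • sigmaEnd σ p := by
  have h1 : HasFDerivAt (fun x => x - p) (ContinuousLinearMap.id ℝ (R4 n)) x :=
    (hasFDerivAt_id x).sub_const p
  have h2 : HasFDerivAt (fun x => sigmaBilin σ (x - p)) (sigmaBilin σ) x :=
    (sigmaBilin σ).hasFDerivAt.comp x h1
  have h3 := ((hasFDerivAt_id x).const_sub ((2 : ℝ) • p)).sub
    ((h2.clm_apply h1).smul_const (sigmaEnd σ p))
  have h4 : HasFDerivAt (sigmaSymmetry σ p) _ x := h3
  rw [h4.fderiv]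
  simp [sigmaBilin_comm σ u]
  module

theorem isIsometry_sigmaSymmetry (p : R4 n) :
    (sigmaMetric σ).IsIsometry (sigmaSymmetry σ p) := by
  refine ⟨contDiff_sigmaSymmetry σ p, ?_, fun x u v => ?_⟩
  · rw [sigmaSymmetry_symm]
    exact contDiff_sigmaSymmetry σ p
  · simp only [sigmaMetric_form_apply, fderiv_sigmaSymmetry, sigmaSymmetry_apply, map_sub, map_neg,
      map_smul, _root_.sub_apply, _root_.neg_apply, _root_.smul_apply, smul_eq_mul,
      sigmaBilin_sigmaEnd_right, sigmaBilin_sigmaEnd_left, flatForm_sigmaEnd_left,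
      flatForm_sigmaEnd_right, sigmaBilin_comm σ u]
    ring

theorem isSymmetryAt_sigmaSymmetry (p : R4 n) :
    (sigmaMetric σ).IsSymmetryAt p (sigmaSymmetry σ p) := by
  refine ⟨isIsometry_sigmaSymmetry σ p, ?_, ?_⟩
  · rw [sigmaSymmetry_apply]
    simp [two_smul]
  · ext1 u
    simp [fderiv_sigmaSymmetry]

theorem isSymmetryAt_sigmaMetric_iff {p : R4 n} {s : Equiv.Perm (R4 n)} :
    (sigmaMetric σ).IsSymmetryAt p s ↔ s = sigmaSymmetry σ p := by
  have h := isSymmetryAt_sigmaSymmetry σ p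
  refine ⟨fun hs => ?_, fun hs => hs ▸ h⟩
  exact eq_of_isIsometry_sigmaMetric hs.1 h.1 (hs.2.1.trans h.2.1.symm) (hs.2.2.trans h.2.2.symm)

theorem isSymmetricSpace_sigmaMetric : (sigmaMetric σ).IsSymmetricSpace :=
  fun p => ⟨_, isSymmetryAt_sigmaSymmetry σ p⟩

theorem transvectionGroup_sigmaMetric : (sigmaMetric σ).transvectionGroup =
    Subgroup.closure {φ | ∃ p q, φ = sigmaSymmetry σ p * sigmaSymmetry σ q} := by
  simp only [SemiRiemannianMetric.transvectionGroup, isSymmetryAt_sigmaMetric_iff]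
  congr 1
  ext φ
  simp

end SigmaSymmetry

/-! ### Composition law and generation of transvections. -/

section SigmaGroup

variable {n : ℕ} (σ : Matrix (Fin n) (Fin n) ℝ)

/-- The space of the endomorphisms of `ℝ^{4n}` that are skew for the flat form and have values in
the kernel of `sigmaEnd σ`. -/
noncomputable def sigmaSkew : Submodule ℝ (R4 n →L[ℝ] R4 n) where
  carrier := {A | (∀ x, sigmaEnd σ (A x) = 0) ∧ ∀ x y, flatForm n (A x) y = -flatForm n x (A y)}
  zero_mem' := by simp
  add_mem' := fun {A B} hA hB => by
    refine ⟨fun x => by simp [hA.1, hB.1], fun x y => ?_⟩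
    simp only [_root_.add_apply, map_add, hA.2 x, hB.2 x]
    ring
  smul_mem' := fun c A hA => by
    refine ⟨fun x => by simp [hA.1], fun x y => ?_⟩
    simp only [_root_.smul_apply, map_smul, hA.2 x, smul_neg]

variable {σ}

/-- By duality: `⟨A J x, y⟩ = -⟨J x, A y⟩ = -⟨x, J A y⟩ = 0`. -/
theorem sigmaSkew_apply_sigmaEnd {A : R4 n →L[ℝ] R4 n} (hA : A ∈ sigmaSkew σ) (x : R4 n) :
    A (sigmaEnd σ x) = 0 := by
  refine eq_zero_of_flatForm fun y => ?_
  rw [hA.2, flatForm_sigmaEnd_left, sigmaBilin_eq_zero_right (hA.1 y), neg_zero]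

theorem sigmaSkew_apply_eq_zero (hdet : σ.det ≠ 0) {A : R4 n →L[ℝ] R4 n} (hA : A ∈ sigmaSkew σ)
    {x : R4 n} (hx : sigmaEnd σ x = 0) : A x = 0 := by
  obtain ⟨z, rfl⟩ := exists_sigmaEnd_eq_of_sigmaEnd_eq_zero hdet hx
  exact sigmaSkew_apply_sigmaEnd hA z

theorem sigmaSkew_mul (hdet : σ.det ≠ 0) {A B : R4 n →L[ℝ] R4 n} (hA : A ∈ sigmaSkew σ)
    (hB : B ∈ sigmaSkew σ) : A * B = 0 := by
  ext1 x
  exact sigmaSkew_apply_eq_zero hdet hA (hB.1 x)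

variable (σ)

/-- The skew endomorphism `x ↦ B(x, a) J b - B(x, b) J a`, where `B = sigmaBilin σ` and
`J = sigmaEnd σ`. -/
noncomputable def sigmaWedge (a b : R4 n) : R4 n →L[ℝ] R4 n :=
  (sigmaBilin σ a).smulRight (sigmaEnd σ b) - (sigmaBilin σ b).smulRight (sigmaEnd σ a)

theorem sigmaWedge_apply (a b x : R4 n) : sigmaWedge σ a b x =
    sigmaBilin σ a x • sigmaEnd σ b - sigmaBilin σ b x • sigmaEnd σ a := rfl

theorem sigmaWedge_mem (a b : R4 n) : sigmaWedge σ a b ∈ sigmaSkew σ := by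
  refine ⟨fun x => ?_, fun x y => ?_⟩
  · simp [sigmaWedge_apply, sigmaEnd_sigmaEnd]
  · simp only [sigmaWedge_apply, map_sub, map_smul, _root_.sub_apply, _root_.smul_apply,
      smul_eq_mul, flatForm_sigmaEnd_left, flatForm_sigmaEnd_right, sigmaBilin_comm σ x]
    ring

/-- The general element of the transvection group of `sigmaMetric σ`, as a map. -/
noncomputable def sigmaMap (a : R4 n) (A : R4 n →L[ℝ] R4 n) (x : R4 n) : R4 n :=
  x + a + A x - ((sigmaBilin σ a x + sigmaBilin σ x x) / 2) • sigmaEnd σ a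

variable {σ}

theorem sigmaEnd_sigmaMap {A : R4 n →L[ℝ] R4 n} (hA : A ∈ sigmaSkew σ) (a x : R4 n) :
    sigmaEnd σ (sigmaMap σ a A x) = sigmaEnd σ x + sigmaEnd σ a := by
  simp [sigmaMap, hA.1, sigmaEnd_sigmaEnd]

/-- The inner map is `x ↦ x + a` modulo `ker J`, which is all that `B`, `J` and the linear map `B`
of the outer one see. The cross terms linear in `x` leave the wedge as their antisymmetric part. -/
theorem sigmaMap_sigmaMap (hdet : σ.det ≠ 0) {A B : R4 n →L[ℝ] R4 n} (hA : A ∈ sigmaSkew σ)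
    (hB : B ∈ sigmaSkew σ) (a b x : R4 n) :
    sigmaMap σ b B (sigmaMap σ a A x) =
      sigmaMap σ (a + b + B a - ((sigmaBilin σ a b + sigmaBilin σ a a) / 2) • sigmaEnd σ b)
        (A + B - (1 / 2 : ℝ) • sigmaWedge σ a b) x := by
  have h1 : B (sigmaMap σ a A x) = B (x + a) := by
    rw [← sub_eq_zero, ← map_sub]
    refine sigmaSkew_apply_eq_zero hdet hB ?_
    simp [sigmaEnd_sigmaMap hA]
  have h2 : sigmaEnd σ (sigmaMap σ a A x) = sigmaEnd σ (x + a) := by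
    rw [sigmaEnd_sigmaMap hA, map_add]
  have h3 : sigmaEnd σ (a + b + B a
      - ((sigmaBilin σ a b + sigmaBilin σ a a) / 2) • sigmaEnd σ b) = sigmaEnd σ (a + b) := by
    simp [hB.1, sigmaEnd_sigmaEnd]
  rw [sigmaMap, h1, sigmaBilin_congr rfl h2, sigmaBilin_congr h2 h2]
  conv_rhs => rw [sigmaMap, h3, sigmaBilin_congr h3 rfl]
  simp only [sigmaMap, sigmaWedge_apply, map_add, _root_.add_apply, _root_.sub_apply,
    _root_.smul_apply, sigmaBilin_comm σ x a, sigmaBilin_comm σ b a]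
  module

theorem sigmaMap_zero_zero (x : R4 n) : sigmaMap σ 0 0 x = x := by
  simp [sigmaMap]

theorem sigmaMap_eq_of_sigmaEnd_eq_zero {a : R4 n} (ha : sigmaEnd σ a = 0)
    (A : R4 n →L[ℝ] R4 n) (x : R4 n) : sigmaMap σ a A x = x + a + A x := by
  simp [sigmaMap, ha]

theorem sigmaMap_neg_sigmaMap (hdet : σ.det ≠ 0) {A : R4 n →L[ℝ] R4 n} (hA : A ∈ sigmaSkew σ)
    (a x : R4 n) : sigmaMap σ (-a + A a) (-A) (sigmaMap σ a A x) = x := by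
  have hJ : sigmaEnd σ (-a + A a) = -sigmaEnd σ a := by simp [hA.1]
  have hJ' : sigmaEnd σ (-a + A a) = sigmaEnd σ (-a) := by simp [hA.1]
  have hw : sigmaWedge σ a (-a + A a) = 0 := by
    ext1 y
    rw [sigmaWedge_apply, hJ, sigmaBilin_congr hJ' rfl]
    simp
  rw [sigmaMap_sigmaMap hdet hA (neg_mem hA), hw, sigmaBilin_congr rfl hJ']
  simp [sigmaMap]

/-- The group of the maps `sigmaMap σ a A`, where `A` runs through `sigmaSkew σ`. -/
noncomputable def sigmaGroup (hdet : σ.det ≠ 0) : Subgroup (Equiv.Perm (R4 n)) where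
  carrier := {φ | ∃ a, ∃ A ∈ sigmaSkew σ, ∀ x, φ x = sigmaMap σ a A x}
  one_mem' := ⟨0, 0, zero_mem _, fun x => (sigmaMap_zero_zero x).symm⟩
  mul_mem' := by
    rintro φ ψ ⟨b, B, hB, hφ⟩ ⟨a, A, hA, hψ⟩
    refine ⟨a + b + B a - ((sigmaBilin σ a b + sigmaBilin σ a a) / 2) • sigmaEnd σ b,
      A + B - (1 / 2 : ℝ) • sigmaWedge σ a b, sub_mem (add_mem hA hB)
      (Submodule.smul_mem _ _ (sigmaWedge_mem σ a b)), fun x => ?_⟩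
    rw [Equiv.Perm.mul_apply, hψ, hφ, sigmaMap_sigmaMap hdet hA hB]
  inv_mem' := by
    rintro φ ⟨a, A, hA, hφ⟩
    refine ⟨-a + A a, -A, neg_mem hA, fun x => ?_⟩
    obtain ⟨y, rfl⟩ := φ.surjective x
    rw [← Equiv.Perm.mul_apply, inv_mul_cancel, Equiv.Perm.one_apply, hφ, sigmaMap_neg_sigmaMap hdet hA]

theorem sigmaSymmetry_zero_apply (x : R4 n) : sigmaSymmetry σ 0 x = -x := by
  simp [sigmaSymmetry_apply]

theorem sigmaSymmetry_sigmaSymmetry_zero_apply (p x : R4 n) :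
    sigmaSymmetry σ p (sigmaSymmetry σ 0 x)
      = sigmaMap σ ((2 : ℝ) • p - sigmaBilin σ p p • sigmaEnd σ p) 0 x := by
  have h : sigmaEnd σ ((2 : ℝ) • p - sigmaBilin σ p p • sigmaEnd σ p)
      = sigmaEnd σ ((2 : ℝ) • p) := by
    simp [sigmaEnd_sigmaEnd]
  rw [sigmaSymmetry_zero_apply, sigmaSymmetry_apply, sigmaMap, h, sigmaBilin_congr h rfl]
  simp only [map_sub, map_neg, map_smul, _root_.sub_apply, _root_.neg_apply, _root_.smul_apply,
    sigmaBilin_comm σ x p, _root_.zero_apply, smul_eq_mul]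
  module

theorem sigmaSymmetry_mul_self (p : R4 n) : sigmaSymmetry σ p * sigmaSymmetry σ p = 1 :=
  Equiv.ext (involutive_sigmaSymmetry σ p)

theorem sigmaSymmetry_mul_mem_transvectionGroup (p q : R4 n) :
    sigmaSymmetry σ p * sigmaSymmetry σ q ∈ (sigmaMetric σ).transvectionGroup := by
  rw [transvectionGroup_sigmaMetric]
  exact Subgroup.subset_closure ⟨p, q, rfl⟩

theorem transvectionGroup_le_sigmaGroup (hdet : σ.det ≠ 0) :
    (sigmaMetric σ).transvectionGroup ≤ sigmaGroup hdet := by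
  have h : ∀ p, sigmaSymmetry σ p * sigmaSymmetry σ 0 ∈ sigmaGroup hdet := fun p =>
    ⟨_, 0, zero_mem _, sigmaSymmetry_sigmaSymmetry_zero_apply p⟩
  rw [transvectionGroup_sigmaMetric, Subgroup.closure_le]
  rintro _ ⟨p, q, rfl⟩
  -- `s_p s_q = (s_p s_0)(s_q s_0)⁻¹`, since symmetries are involutions.
  have := mul_mem (h p) (inv_mem (h q))
  rwa [mul_inv_rev, mul_assoc, mul_inv_cancel_left,
    inv_eq_of_mul_eq_one_left (sigmaSymmetry_mul_self q)] at this

theorem addRight_mem_transvectionGroup {b : R4 n} (hb : sigmaEnd σ b = 0) :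
    Equiv.addRight b ∈ (sigmaMetric σ).transvectionGroup := by
  convert sigmaSymmetry_mul_mem_transvectionGroup (σ := σ) ((1 / 2 : ℝ) • b) 0 using 1
  ext1 x
  simp [sigmaSymmetry_sigmaSymmetry_zero_apply, sigmaMap, hb]

theorem exists_sigmaMap_zero_mem_transvectionGroup (a : R4 n) :
    ∃ φ ∈ (sigmaMetric σ).transvectionGroup, ∀ x, φ x = sigmaMap σ a 0 x := by
  -- The product `s_{a/2} s_0` has the right parameter up to a vector of `im J`, which a translation
  -- corrects.
  refine ⟨_, mul_mem (addRight_mem_transvectionGroup (σ := σ)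
    (b := sigmaBilin σ ((1 / 2 : ℝ) • a) ((1 / 2 : ℝ) • a) • sigmaEnd σ ((1 / 2 : ℝ) • a)) ?_)
    (sigmaSymmetry_mul_mem_transvectionGroup ((1 / 2 : ℝ) • a) 0), fun x => ?_⟩
  · simp [sigmaEnd_sigmaEnd]
  · rw [Equiv.Perm.mul_apply, Equiv.Perm.mul_apply, sigmaSymmetry_sigmaSymmetry_zero_apply]
    have h : (2 : ℝ) • (1 / 2 : ℝ) • a = a := by module
    rw [h]
    generalize hc : sigmaBilin σ ((1 / 2 : ℝ) • a) ((1 / 2 : ℝ) • a) •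
      sigmaEnd σ ((1 / 2 : ℝ) • a) = c
    have hc' : sigmaEnd σ (a - c) = sigmaEnd σ a := by
      simp [← hc, sigmaEnd_sigmaEnd]
    rw [sigmaMap, sigmaMap, hc', sigmaBilin_congr hc' rfl]
    simp only [Equiv.coe_addRight, _root_.zero_apply]
    module

/-- The elements `A` of `sigmaSkew σ` for which `1 + A` is a transvection. -/
noncomputable def sigmaSkewTransvection (hdet : σ.det ≠ 0) :
    AddSubmonoid (R4 n →L[ℝ] R4 n) where
  carrier := {A | A ∈ sigmaSkew σ ∧
    ∃ φ ∈ (sigmaMetric σ).transvectionGroup, ∀ x, φ x = x + A x}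
  zero_mem' := ⟨zero_mem _, 1, one_mem _, by simp⟩
  add_mem' := by
    rintro A B ⟨hA, φ, hφ, hφ'⟩ ⟨hB, ψ, hψ, hψ'⟩
    refine ⟨add_mem hA hB, φ * ψ, mul_mem hφ hψ, fun x => ?_⟩
    rw [Equiv.Perm.mul_apply, hψ', hφ', map_add, sigmaSkew_apply_eq_zero hdet hA (hB.1 x)]
    simp only [_root_.add_apply]
    abel

theorem sigmaWedge_mem_sigmaSkewTransvection (hdet : σ.det ≠ 0) (a b : R4 n) :
    sigmaWedge σ a b ∈ sigmaSkewTransvection hdet := by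
  refine ⟨sigmaWedge_mem σ a b, ?_⟩
  -- This rescaling absorbs the factor `-1/2` of the wedge in the composition law.
  obtain ⟨a, rfl⟩ : ∃ a', a = (-1 / 2 : ℝ) • a' := ⟨(-2 : ℝ) • a, by module⟩
  obtain ⟨φ, hφ, hφ'⟩ := exists_sigmaMap_zero_mem_transvectionGroup (σ := σ) a
  obtain ⟨ψ, hψ, hψ'⟩ := exists_sigmaMap_zero_mem_transvectionGroup (σ := σ) b
  -- The parameter `-(a + b)` cancels the translation modulo `ker J` and adds no wedge, because the
  -- composite of `φ` and `ψ` has parameter congruent to `a + b`.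
  obtain ⟨χ, hχ, hχ'⟩ := exists_sigmaMap_zero_mem_transvectionGroup (σ := σ) (-(a + b))
  have h0 := zero_mem (sigmaSkew σ)
  have h : ∀ x, (ψ * (φ * χ)) x = sigmaMap σ _ _ x := fun x => by
    rw [Equiv.Perm.mul_apply, Equiv.Perm.mul_apply, hψ', hφ', hχ', sigmaMap_sigmaMap hdet h0 h0,
      sigmaMap_sigmaMap hdet h0 (sub_mem (add_mem h0 h0) (Submodule.smul_mem _ _
        (sigmaWedge_mem σ _ _)))]
  generalize hd : a + b + (0 : R4 n →L[ℝ] R4 n) a -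
    ((sigmaBilin σ a b + sigmaBilin σ a a) / 2) • sigmaEnd σ b = d at h
  have hdJ : sigmaEnd σ d = sigmaEnd σ (a + b) := by
    simp [← hd, sigmaEnd_sigmaEnd]
  generalize he : -(a + b) + d + _ - (_ : ℝ) • sigmaEnd σ d = e at h
  have heJ : sigmaEnd σ e = 0 := by
    simp [← he, hdJ, sigmaEnd_sigmaEnd, sigmaWedge_apply]
  refine ⟨_, mul_mem (addRight_mem_transvectionGroup (σ := σ) (b := -e) (by simp [heJ]))
    (mul_mem hψ (mul_mem hφ hχ)), fun x => ?_⟩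
  rw [Equiv.Perm.mul_apply, h, sigmaMap_eq_of_sigmaEnd_eq_zero heJ]
  simp only [Equiv.coe_addRight, sigmaWedge_apply, _root_.sub_apply, _root_.add_apply,
    _root_.smul_apply, _root_.zero_apply, hdJ, sigmaBilin_congr hdJ rfl, map_neg, map_add,
    _root_.neg_apply, map_smul, smul_eq_mul]
  module

end SigmaGroup

/-! ### Nilpotency class and derived length. -/

section SigmaNilpotent

variable {n : ℕ} {σ : Matrix (Fin n) (Fin n) ℝ}

/-- The elements of `sigmaGroup` that induce the identity modulo the kernel of `sigmaEnd σ`. -/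
noncomputable def sigmaUnipotent (hdet : σ.det ≠ 0) : Subgroup (Equiv.Perm (R4 n)) where
  carrier := {φ | ∃ b, sigmaEnd σ b = 0 ∧ ∃ A ∈ sigmaSkew σ, ∀ x, φ x = x + b + A x}
  one_mem' := ⟨0, by simp, 0, zero_mem _, by simp⟩
  mul_mem' := by
    rintro φ ψ ⟨b, hb, A, hA, hφ⟩ ⟨c, hc, B, hB, hψ⟩
    refine ⟨b + c, by simp [hb, hc], A + B, add_mem hA hB, fun x => ?_⟩
    rw [Equiv.Perm.mul_apply, hψ, hφ, map_add, map_add, sigmaSkew_apply_eq_zero hdet hA hc,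
      sigmaSkew_apply_eq_zero hdet hA (hB.1 x), _root_.add_apply]
    abel
  inv_mem' := by
    rintro φ ⟨b, hb, A, hA, hφ⟩
    refine ⟨-b, by simp [hb], -A, neg_mem hA, fun x => ?_⟩
    obtain ⟨y, rfl⟩ := φ.surjective x
    rw [← Equiv.Perm.mul_apply, inv_mul_cancel, Equiv.Perm.one_apply, hφ, _root_.neg_apply,
      map_add, map_add, sigmaSkew_apply_eq_zero hdet hA hb,
      sigmaSkew_apply_eq_zero hdet hA (hA.1 y)]
    abel

variable (σ) in
/-- The group of translations by elements of the kernel of `sigmaEnd σ`. -/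
noncomputable def sigmaTranslation : Subgroup (Equiv.Perm (R4 n)) where
  carrier := {φ | ∃ b, sigmaEnd σ b = 0 ∧ ∀ x, φ x = x + b}
  one_mem' := ⟨0, by simp, by simp⟩
  mul_mem' := by
    rintro φ ψ ⟨b, hb, hφ⟩ ⟨c, hc, hψ⟩
    exact ⟨c + b, by simp [hb, hc], fun x => by rw [Equiv.Perm.mul_apply, hψ, hφ, add_assoc]⟩
  inv_mem' := by
    rintro φ ⟨b, hb, hφ⟩
    refine ⟨-b, by simp [hb], fun x => ?_⟩
    obtain ⟨y, rfl⟩ := φ.surjective x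
    rw [← Equiv.Perm.mul_apply, inv_mul_cancel, Equiv.Perm.one_apply, hφ, add_neg_cancel_right]

/-- Modulo `ker J` an element of `sigmaGroup` is a translation, so one fixed class forces it to be
the identity there. -/
theorem mem_sigmaUnipotent_of_sigmaEnd_apply {hdet : σ.det ≠ 0} {φ : Equiv.Perm (R4 n)}
    (hφ : φ ∈ sigmaGroup hdet) {x : R4 n} (hx : sigmaEnd σ (φ x) = sigmaEnd σ x) :
    φ ∈ sigmaUnipotent hdet := by
  obtain ⟨a, A, hA, h⟩ := hφ
  rw [h, sigmaEnd_sigmaMap hA, add_eq_left] at hx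
  exact ⟨a, hx, A, hA, fun x => by rw [h, sigmaMap_eq_of_sigmaEnd_eq_zero hx]⟩

theorem commutator_mem_sigmaUnipotent {hdet : σ.det ≠ 0} {φ ψ : Equiv.Perm (R4 n)}
    (hφ : φ ∈ sigmaGroup hdet) (hψ : ψ ∈ sigmaGroup hdet) :
    φ * ψ * φ⁻¹ * ψ⁻¹ ∈ sigmaUnipotent hdet := by
  have h := mul_mem (mul_mem (mul_mem hφ hψ) (inv_mem hφ)) (inv_mem hψ)
  refine mem_sigmaUnipotent_of_sigmaEnd_apply h (x := ψ (φ 0)) ?_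
  have e : (φ * ψ * φ⁻¹ * ψ⁻¹) (ψ (φ 0)) = φ (ψ 0) := by simp
  rw [e]
  obtain ⟨a, A, hA, hφ⟩ := hφ
  obtain ⟨b, B, hB, hψ⟩ := hψ
  rw [hφ, sigmaEnd_sigmaMap hA, hψ, sigmaEnd_sigmaMap hB, hψ, sigmaEnd_sigmaMap hB, hφ,
    sigmaEnd_sigmaMap hA]
  abel

theorem sigmaMap_add {A : R4 n →L[ℝ] R4 n} (hdet : σ.det ≠ 0) (hA : A ∈ sigmaSkew σ)
    (a x : R4 n) {w : R4 n} (hw : sigmaEnd σ w = 0) :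
    sigmaMap σ a A (x + w) = sigmaMap σ a A x + w := by
  have h : sigmaEnd σ (x + w) = sigmaEnd σ x := by simp [hw]
  rw [sigmaMap, sigmaMap, sigmaBilin_congr rfl h, sigmaBilin_congr h h, map_add,
    sigmaSkew_apply_eq_zero hdet hA hw]
  abel

theorem commutator_mem_sigmaTranslation {hdet : σ.det ≠ 0} {φ ψ : Equiv.Perm (R4 n)}
    (hφ : φ ∈ sigmaUnipotent hdet) (hψ : ψ ∈ sigmaGroup hdet) :
    φ * ψ * φ⁻¹ * ψ⁻¹ ∈ sigmaTranslation σ := by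
  obtain ⟨b, hb, A, hA, hφ⟩ := hφ
  obtain ⟨c, B, hB, hψ⟩ := hψ
  -- With `ψ` translating by `c` modulo `ker J`, the maps `φ ψ` and `ψ φ` differ exactly by `A c`.
  refine ⟨A c, hA.1 c, fun x => ?_⟩
  obtain ⟨y, rfl⟩ : ∃ y, x = ψ (φ y) := ⟨φ⁻¹ (ψ⁻¹ x), by simp⟩
  have e : (φ * ψ * φ⁻¹ * ψ⁻¹) (ψ (φ y)) = φ (ψ y) := by simp
  have hAψ : A (sigmaMap σ c B y) = A (y + c) := by
    rw [← sub_eq_zero, ← map_sub]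
    exact sigmaSkew_apply_eq_zero hdet hA (by simp [sigmaEnd_sigmaMap hB])
  rw [e, hφ, hφ, hψ, hψ, hAψ, add_assoc y, sigmaMap_add hdet hB _ _ (by simp [hb, hA.1]), map_add]
  abel

theorem commute_sigmaTranslation {hdet : σ.det ≠ 0} {φ ψ : Equiv.Perm (R4 n)}
    (hφ : φ ∈ sigmaTranslation σ) (hψ : ψ ∈ sigmaGroup hdet) : φ * ψ = ψ * φ := by
  obtain ⟨b, hb, hφ⟩ := hφ
  obtain ⟨c, B, hB, hψ⟩ := hψ
  ext1 x
  rw [Equiv.Perm.mul_apply, Equiv.Perm.mul_apply, hφ, hφ, hψ, hψ, sigmaMap_add hdet hB _ _ hb]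

theorem commute_sigmaUnipotent {hdet : σ.det ≠ 0} {φ ψ : Equiv.Perm (R4 n)}
    (hφ : φ ∈ sigmaUnipotent hdet) (hψ : ψ ∈ sigmaUnipotent hdet) : φ * ψ = ψ * φ := by
  obtain ⟨b, hb, A, hA, hφ⟩ := hφ
  obtain ⟨c, hc, B, hB, hψ⟩ := hψ
  ext1 x
  simp only [Equiv.Perm.mul_apply, hφ, hψ, map_add, sigmaSkew_apply_eq_zero hdet hA hc,
    sigmaSkew_apply_eq_zero hdet hB hb, sigmaSkew_apply_eq_zero hdet hA (hB.1 x),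
    sigmaSkew_apply_eq_zero hdet hB (hA.1 x)]
  abel

/-- A descending central series of the transvection group of `sigmaMetric σ`. -/
noncomputable def sigmaSeries (hdet : σ.det ≠ 0) : ℕ → Subgroup (sigmaMetric σ).transvectionGroup
  | 0 => ⊤
  | 1 => (sigmaUnipotent hdet).subgroupOf _
  | 2 => (sigmaTranslation σ).subgroupOf _
  | _ => ⊥

theorem isDescendingCentralSeries_sigmaSeries (hdet : σ.det ≠ 0) :
    Subgroup.IsDescendingCentralSeries (sigmaSeries hdet) := by
  refine ⟨rfl, fun x k hx g => ?_⟩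
  have hmem := fun y : (sigmaMetric σ).transvectionGroup =>
    transvectionGroup_le_sigmaGroup hdet y.2
  match k, hx with
  | 0, _ => exact commutator_mem_sigmaUnipotent (hmem x) (hmem g)
  | 1, hx => exact commutator_mem_sigmaTranslation hx (hmem g)
  | 2, hx =>
    refine Subgroup.mem_bot.2 (commutatorElement_eq_one_iff_mul_comm.2 (Subtype.ext ?_))
    exact commute_sigmaTranslation hx (hmem g)
  | k + 3, hx =>
    obtain rfl : x = 1 := Subgroup.mem_bot.1 hx
    exact Subgroup.mem_bot.2 (by simp)

theorem sigmaMap_sigmaMap_comm (a b : R4 n) :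
    ∃ e, ∀ x, sigmaMap σ a 0 (sigmaMap σ b 0 x)
      = sigmaMap σ b 0 (sigmaMap σ a 0 x) + e + sigmaWedge σ a b x := by
  refine ⟨sigmaMap σ a 0 (sigmaMap σ b 0 0) - sigmaMap σ b 0 (sigmaMap σ a 0 0), fun x => ?_⟩
  simp only [sigmaMap, sigmaWedge_apply, map_add, map_sub, map_smul, map_zero, _root_.add_apply,
    _root_.sub_apply, _root_.smul_apply, _root_.zero_apply, smul_eq_mul, sigmaBilin_sigmaEnd_left,
    sigmaBilin_sigmaEnd_right, sigmaBilin_comm σ x, sigmaBilin_comm σ b a]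
  module

theorem exists_sigmaWedge_apply_ne_zero (hn : 1 ≤ n) (hdet : σ.det ≠ 0) :
    ∃ a b c, sigmaWedge σ a b c ≠ 0 := by
  by_contra! h
  set v : Fin n → ℝ := Pi.single ⟨0, hn⟩ 1
  have hv : v ≠ 0 := by simp [v]
  have ha : sigmaEnd σ (Pi.single 0 v) ≠ 0 := by
    rw [Ne, sigmaEnd_eq_zero_iff hdet]
    simp [hv]
  refine ha (eq_zero_of_flatForm fun c => ?_)
  rw [flatForm_sigmaEnd_left]
  have h2 := congrFun (h (Pi.single 0 v) (Pi.single 1 v) c) 2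
  rw [sigmaWedge_apply, sigmaEnd_apply, sigmaEnd_apply] at h2
  have hσv : σ.mulVec v ≠ 0 := fun h0 => hv (Matrix.eq_zero_of_mulVec_eq_zero hdet h0)
  simpa [hσv] using h2

theorem exists_commutator_commutator_ne_one (hn : 1 ≤ n) (hdet : σ.det ≠ 0) :
    ∃ f g h : (sigmaMetric σ).transvectionGroup,
      (f * g * f⁻¹ * g⁻¹) * h * (f * g * f⁻¹ * g⁻¹)⁻¹ * h⁻¹ ≠ 1 := by
  obtain ⟨a, b, c, habc⟩ := exists_sigmaWedge_apply_ne_zero hn hdet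
  obtain ⟨f, hf, hf'⟩ := exists_sigmaMap_zero_mem_transvectionGroup (σ := σ) a
  obtain ⟨g, hg, hg'⟩ := exists_sigmaMap_zero_mem_transvectionGroup (σ := σ) b
  obtain ⟨h, hh, hh'⟩ := exists_sigmaMap_zero_mem_transvectionGroup (σ := σ) c
  refine ⟨⟨f, hf⟩, ⟨g, hg⟩, ⟨h, hh⟩, fun h1 => habc ?_⟩
  replace h1 := congrArg Subtype.val h1
  simp only [Subgroup.coe_mul, Subgroup.coe_inv, Subgroup.coe_one] at h1
  obtain ⟨e, he, A, hA, hz⟩ := commutator_mem_sigmaUnipotent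
    (transvectionGroup_le_sigmaGroup hdet hf) (transvectionGroup_le_sigmaGroup hdet hg)
  have hfg : ∀ x, f (g x) = (f * g * f⁻¹ * g⁻¹) (g (f x)) := fun x => by simp
  generalize f * g * f⁻¹ * g⁻¹ = z at *
  have hJ : ∀ (d x : R4 n), A (sigmaMap σ d 0 x) = A x + A d := fun d x => by
    rw [← sub_eq_zero, ← map_add, ← map_sub]
    exact sigmaSkew_apply_eq_zero hdet hA (by simp [sigmaEnd_sigmaMap (zero_mem _)])
  -- The linear part of the commutator of `f` and `g` is found by comparing `f g` with `g f` at `c`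
  -- and at `0`.
  have hAw : A c = sigmaWedge σ a b c := by
    obtain ⟨e', he'⟩ := sigmaMap_sigmaMap_comm (σ := σ) a b
    have hx : ∀ x, e + (A x + A a + A b) = e' + sigmaWedge σ a b x := by
      intro x
      have := hfg x
      rw [hz, hf', hg', hg', hf', he', hJ, hJ, add_assoc, add_assoc] at this
      exact (add_left_cancel this).symm
    have h0 := hx 0
    have hc := hx c
    simp only [map_zero, zero_add, add_zero] at h0
    rw [← h0] at hc
    have : A c + (e + (A a + A b)) = sigmaWedge σ a b c + (e + (A a + A b)) := by
      rw [← add_comm _ (sigmaWedge σ a b c), ← hc]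
      abel
    exact add_right_cancel this
  have hcomm : z * h = h * z := by
    rwa [mul_inv_eq_one, mul_inv_eq_iff_eq_mul] at h1
  have h0 := DFunLike.congr_fun hcomm 0
  rw [Equiv.Perm.mul_apply, Equiv.Perm.mul_apply, hz, hz, hh', hh', hJ] at h0
  rw [map_zero, add_zero, sigmaMap_add hdet (zero_mem _) _ _ he] at h0
  rw [← hAw]
  simpa using h0

theorem lowerCentralSeries_two_ne_bot (hn : 1 ≤ n) (hdet : σ.det ≠ 0) :
    (⊤ : Subgroup (sigmaMetric σ).transvectionGroup).lowerCentralSeries 2 ≠ ⊥ := by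
  obtain ⟨f, g, h, hne⟩ := exists_commutator_commutator_ne_one hn hdet
  intro hbot
  have hd := Subgroup.lowerCentralSeries_isDescendingCentralSeries
    (G := (sigmaMetric σ).transvectionGroup)
  have := hd.2 _ 1 (hd.2 f 0 (Subgroup.mem_top f) g) h
  rw [hbot, Subgroup.mem_bot] at this
  exact hne this

theorem isNilpotent_transvectionGroup (hdet : σ.det ≠ 0) :
    Group.IsNilpotent (sigmaMetric σ).transvectionGroup :=
  (Subgroup.nilpotent_iff_finite_descending_central_series _).2
    ⟨3, sigmaSeries hdet, isDescendingCentralSeries_sigmaSeries hdet, rfl⟩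

theorem nilpotencyClass_transvectionGroup (hn : 1 ≤ n) (hdet : σ.det ≠ 0)
    [Group.IsNilpotent (sigmaMetric σ).transvectionGroup] :
    Group.nilpotencyClass (sigmaMetric σ).transvectionGroup = 3 := by
  refine le_antisymm ?_ (Nat.succ_le_of_lt (lt_of_not_ge fun h => ?_))
  · rw [← Subgroup.lowerCentralSeries_eq_bot_iff_nilpotencyClass_le, eq_bot_iff]
    exact Subgroup.descending_central_series_ge_lower _
      (isDescendingCentralSeries_sigmaSeries hdet) 3
  · rw [← Subgroup.lowerCentralSeries_eq_bot_iff_nilpotencyClass_le] at h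
    exact lowerCentralSeries_two_ne_bot hn hdet h

theorem derivedSeries_two_transvectionGroup (hdet : σ.det ≠ 0) :
    derivedSeries (sigmaMetric σ).transvectionGroup 2 = ⊥ := by
  have h1 : derivedSeries (sigmaMetric σ).transvectionGroup 1
      ≤ (sigmaUnipotent hdet).subgroupOf _ := by
    rw [derivedSeries_succ, Subgroup.commutator_le]
    exact fun f _ g _ => commutator_mem_sigmaUnipotent
      (transvectionGroup_le_sigmaGroup hdet f.2) (transvectionGroup_le_sigmaGroup hdet g.2)
  rw [derivedSeries_succ, eq_bot_iff, Subgroup.commutator_le]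
  intro f hf g hg
  rw [Subgroup.mem_bot, commutatorElement_eq_one_iff_mul_comm]
  exact Subtype.ext (commute_sigmaUnipotent (hdet := hdet) (h1 hf) (h1 hg))

theorem derivedSeries_one_transvectionGroup_ne_bot (hn : 1 ≤ n) (hdet : σ.det ≠ 0) :
    derivedSeries (sigmaMetric σ).transvectionGroup 1 ≠ ⊥ := by
  intro h
  refine lowerCentralSeries_two_ne_bot hn hdet (eq_bot_iff.2 ?_)
  refine (Subgroup.lowerCentralSeries_antitone _ one_le_two).trans ?_
  rw [Subgroup.top_lowerCentralSeries_one, ← derivedSeries_one, h]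

end SigmaNilpotent

/-! ### Dimension of `so` and exponentials of square-zero elements. -/

/-- A skew matrix is freely determined by its entries above the diagonal, for any ordering of the
indices. -/
theorem finrank_so (ι : Type*) [Fintype ι] [DecidableEq ι] :
    Module.finrank ℝ (LieAlgebra.Orthogonal.so ι ℝ) = (Fintype.card ι).choose 2 := by
  let _ : LinearOrder ι := LinearOrder.lift' (Fintype.equivFin ι) (Fintype.equivFin ι).injective
  let f : LieAlgebra.Orthogonal.so ι ℝ →ₗ[ℝ] {x : ι × ι // x.1 < x.2} → ℝ :=
    { toFun := fun M x => (M : Matrix ι ι ℝ) x.1.1 x.1.2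
      map_add' := fun _ _ => rfl
      map_smul' := fun _ _ => rfl }
  have hskew : ∀ M : LieAlgebra.Orthogonal.so ι ℝ, ∀ i j,
      (M : Matrix ι ι ℝ) j i = -(M : Matrix ι ι ℝ) i j := fun M i j =>
    congrFun (congrFun ((LieAlgebra.Orthogonal.mem_so _ _ _).1 M.2) i) j
  have hf : Function.Bijective f := by
    refine ⟨(injective_iff_map_eq_zero f).2 fun M hM => Subtype.ext ?_, fun c => ?_⟩
    · have hlt : ∀ i j, i < j → (M : Matrix ι ι ℝ) i j = 0 := fun i j hij =>
        congrFun hM ⟨(i, j), hij⟩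
      ext i j
      rcases lt_trichotomy i j with h | rfl | h
      · exact hlt i j h
      · have := hskew M i i
        change (M : Matrix ι ι ℝ) i i = 0
        linarith
      · rw [hskew M j i, hlt j i h]
        simp
    · refine ⟨⟨Matrix.of fun i j => if h : i < j then c ⟨(i, j), h⟩
        else if h : j < i then -c ⟨(j, i), h⟩ else 0, ?_⟩, ?_⟩
      · rw [LieAlgebra.Orthogonal.mem_so]
        ext i j
        rcases lt_trichotomy i j with h | rfl | h <;> simp [Matrix.transpose_apply, *, not_lt_of_gt]
      · funext x
        change dite _ _ _ = c x
        rw [dif_pos x.2]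
  rw [(LinearEquiv.ofBijective f hf).finrank_eq, Module.finrank_fintype_fun_eq_card,
    Fintype.card_subtype, Fintype.card_product_filter_lt]

theorem exp_eq_one_add_of_mul_self_eq_zero {𝔸 : Type*} [NormedRing 𝔸] [NormedAlgebra ℝ 𝔸] {a : 𝔸}
    (ha : a * a = 0) : NormedSpace.exp a = 1 + a := by
  rw [NormedSpace.exp_eq_tsum ℝ]
  beta_reduce
  rw [tsum_eq_sum (s := Finset.range 2) fun k hk => ?_]
  · simp [Finset.sum_range_succ]
  · obtain ⟨m, rfl⟩ : ∃ m, k = 2 + m := Nat.exists_eq_add_of_le (not_lt.1 fun h => hk (Finset.mem_range.2 h))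
    rw [pow_add, pow_two, ha, zero_mul, smul_zero]

/-! ### The isotropy group and its Lie algebra. -/

section SigmaIsotropy

variable {n : ℕ}

/-- The standard basis vectors of the first two blocks. -/
def frameVec (k : Fin 2 × Fin n) : R4 n := Pi.single (Fin.castAdd 2 k.1) (Pi.single k.2 1)

/-- The standard basis vectors of the last two blocks. -/
def coframeVec (k : Fin 2 × Fin n) : R4 n := Pi.single (Fin.natAdd 2 k.1) (Pi.single k.2 1)

theorem flatForm_coframeVec (k : Fin 2 × Fin n) (x : R4 n) :
    flatForm n (coframeVec k) x = x (Fin.castAdd 2 k.1) k.2 := by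
  obtain ⟨k, i⟩ := k
  rw [flatForm_apply]
  fin_cases k <;> simp [coframeVec, Pi.single_apply]

theorem flatForm_frameVec (k : Fin 2 × Fin n) (x : R4 n) :
    flatForm n (frameVec k) x = x (Fin.natAdd 2 k.1) k.2 := by
  obtain ⟨k, i⟩ := k
  rw [flatForm_apply]
  fin_cases k <;> simp [frameVec, Pi.single_apply]

theorem flatForm_coframeVec_frameVec (k l : Fin 2 × Fin n) :
    flatForm n (coframeVec k) (frameVec l) = if k = l then 1 else 0 := by
  rw [flatForm_coframeVec, frameVec]
  obtain ⟨k, i⟩ := k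
  obtain ⟨l, j⟩ := l
  by_cases h : k = l
  · subst h
    simp [Pi.single_apply]
  · rw [Pi.single_eq_of_ne ((Fin.castAdd_injective 2 2).ne h)]
    simp [h]

theorem sum_coframeVec_add_sum_frameVec (x : R4 n) :
    x = ∑ k, flatForm n (coframeVec k) x • frameVec k
      + ∑ k, flatForm n (frameVec k) x • coframeVec k := by
  funext k i
  simp only [flatForm_coframeVec, flatForm_frameVec]
  simp only [frameVec, coframeVec, Fintype.sum_prod_type,
    Fin.sum_univ_two]
  fin_cases k <;> simp [Pi.single_apply]

variable {σ : Matrix (Fin n) (Fin n) ℝ}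

theorem sigmaEnd_coframeVec (σ : Matrix (Fin n) (Fin n) ℝ) (k : Fin 2 × Fin n) :
    sigmaEnd σ (coframeVec k) = 0 := by
  obtain ⟨k, i⟩ := k
  funext l
  rw [sigmaEnd_apply]
  fin_cases k <;> fin_cases l <;> simp [coframeVec]

theorem flatForm_coframeVec_eq_zero (hdet : σ.det ≠ 0) {x : R4 n} (hx : sigmaEnd σ x = 0)
    (k : Fin 2 × Fin n) : flatForm n (coframeVec k) x = 0 := by
  obtain ⟨z, hz⟩ := exists_sigmaEnd_eq_of_sigmaEnd_eq_zero hdet (sigmaEnd_coframeVec σ k)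
  rw [← hz, flatForm_sigmaEnd_left, sigmaBilin_eq_zero_right hx]

/-- `A` kills the coframe vectors and takes values in their span, so only its entries from frame to
coframe remain. -/
theorem sigmaSkew_apply_eq_sum (hdet : σ.det ≠ 0) {A : R4 n →L[ℝ] R4 n} (hA : A ∈ sigmaSkew σ)
    (x : R4 n) : A x = ∑ k, ∑ l, (flatForm n (A (frameVec k)) (frameVec l)
      * flatForm n (coframeVec k) x) • coframeVec l := by
  have h1 : A x = ∑ k, flatForm n (coframeVec k) x • A (frameVec k) := by
    conv_lhs => rw [sum_coframeVec_add_sum_frameVec x]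
    simp [map_sum, sigmaSkew_apply_eq_zero hdet hA (sigmaEnd_coframeVec σ _)]
  rw [h1]
  refine Finset.sum_congr rfl fun k _ => ?_
  conv_lhs => rw [sum_coframeVec_add_sum_frameVec (A (frameVec k))]
  simp only [flatForm_coframeVec_eq_zero hdet (hA.1 _), zero_smul, Finset.sum_const_zero, zero_add,
    Finset.smul_sum, smul_smul]
  refine Finset.sum_congr rfl fun l _ => ?_
  rw [flatForm_comm (frameVec l), mul_comm]

/-- The matrix of an element of `sigmaSkew σ`. -/
noncomputable def sigmaSkewToSo (σ : Matrix (Fin n) (Fin n) ℝ) :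
    sigmaSkew σ →ₗ[ℝ] LieAlgebra.Orthogonal.so (Fin 2 × Fin n) ℝ where
  toFun A := ⟨Matrix.of fun k l => flatForm n ((A : R4 n →L[ℝ] R4 n) (frameVec k)) (frameVec l), by
    rw [LieAlgebra.Orthogonal.mem_so]
    ext k l
    rw [Matrix.transpose_apply, Matrix.neg_apply, Matrix.of_apply, Matrix.of_apply, A.2.2, flatForm_comm]⟩
  map_add' A B := by
    ext k l
    simp
  map_smul' c A := by
    ext k l
    simp

theorem sigmaSkewToSo_apply (A : sigmaSkew σ) (k l : Fin 2 × Fin n) :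
    (sigmaSkewToSo σ A : Matrix _ _ ℝ) k l
      = flatForm n ((A : R4 n →L[ℝ] R4 n) (frameVec k)) (frameVec l) := rfl

theorem bijective_sigmaSkewToSo (hdet : σ.det ≠ 0) : Function.Bijective (sigmaSkewToSo σ) := by
  refine ⟨(injective_iff_map_eq_zero _).2 fun A hA => Subtype.ext ?_, fun M => ?_⟩
  · ext1 x
    rw [sigmaSkew_apply_eq_sum hdet A.2]
    simp only [← sigmaSkewToSo_apply, hA]
    simp
  · set A : R4 n →L[ℝ] R4 n := ∑ k, ∑ l, (M : Matrix (Fin 2 × Fin n) (Fin 2 × Fin n) ℝ) k l •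
      (flatForm n (coframeVec k)).smulRight (coframeVec l) with hA
    have happ : ∀ x y, flatForm n (A x) y = ∑ k, ∑ l,
        (M : Matrix (Fin 2 × Fin n) (Fin 2 × Fin n) ℝ) k l *
          (flatForm n (coframeVec k) x * flatForm n (coframeVec l) y) := by
      intro x y
      simp [hA, map_sum, _root_.sum_apply]
    have hskew : ∀ i j, (M : Matrix (Fin 2 × Fin n) (Fin 2 × Fin n) ℝ) j i
        = -(M : Matrix (Fin 2 × Fin n) (Fin 2 × Fin n) ℝ) i j := fun i j =>
      congrFun (congrFun ((LieAlgebra.Orthogonal.mem_so _ _ _).1 M.2) i) j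
    refine ⟨⟨A, fun x => ?_, fun x y => ?_⟩, ?_⟩
    · simp [hA, map_sum, _root_.sum_apply, sigmaEnd_coframeVec]
    · rw [flatForm_comm x, happ, happ, Finset.sum_comm]
      simp only [← Finset.sum_neg_distrib]
      refine Finset.sum_congr rfl fun k _ => Finset.sum_congr rfl fun l _ => ?_
      rw [hskew k l]
      ring
    · ext k l
      rw [sigmaSkewToSo_apply]
      simp [happ, flatForm_coframeVec_frameVec]

theorem finrank_sigmaSkew (hdet : σ.det ≠ 0) :
    Module.finrank ℝ (sigmaSkew σ) = n * (2 * n - 1) := by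
  rw [(LinearEquiv.ofBijective _ (bijective_sigmaSkewToSo hdet)).finrank_eq, finrank_so,
    Fintype.card_prod, Fintype.card_fin, Fintype.card_fin, Nat.choose_two_right, mul_assoc,
    Nat.mul_div_cancel_left _ two_pos]

theorem sigmaSkew_eq_sum_sigmaWedge (hdet : σ.det ≠ 0) {A : R4 n →L[ℝ] R4 n}
    (hA : A ∈ sigmaSkew σ) : ∃ (d : Fin 2 × Fin n → R4 n)
      (c : Fin 2 × Fin n → Fin 2 × Fin n → ℝ),
      A = ∑ k, ∑ l, sigmaWedge σ (c k l • d k) (d l) := by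
  choose d hd using fun k : Fin 2 × Fin n =>
    exists_sigmaEnd_eq_of_sigmaEnd_eq_zero hdet (sigmaEnd_coframeVec σ k)
  -- Each wedge accounts for both the `(k, l)` and the `(l, k)` entry of the skew matrix, hence the
  -- half in a sum over all pairs.
  refine ⟨d, fun k l => flatForm n (A (frameVec k)) (frameVec l) / 2, ?_⟩
  ext1 x
  have h1 := sigmaSkew_apply_eq_sum hdet hA x
  have h2 := h1
  rw [Finset.sum_comm] at h2
  have h3 : A x = (1 / 2 : ℝ) • (A x + A x) := by module
  rw [h3]
  nth_rewrite 1 [h1]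
  rw [h2, ← Finset.sum_add_distrib, Finset.smul_sum, _root_.sum_apply]
  refine Finset.sum_congr rfl fun k _ => ?_
  rw [← Finset.sum_add_distrib, Finset.smul_sum, _root_.sum_apply]
  refine Finset.sum_congr rfl fun l _ => ?_
  rw [hA.2 (frameVec l), flatForm_comm (frameVec l), sigmaWedge_apply, map_smul, map_smul, hd, hd,
    ← flatForm_sigmaEnd_left, hd, _root_.smul_apply, ← flatForm_sigmaEnd_left, hd, smul_eq_mul]
  module

/-- Closure under addition suffices: scalars are absorbed into the first argument of each wedge. -/
theorem sigmaSkew_le_sigmaSkewTransvection (hdet : σ.det ≠ 0) {A : R4 n →L[ℝ] R4 n}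
    (hA : A ∈ sigmaSkew σ) : A ∈ sigmaSkewTransvection hdet := by
  obtain ⟨d, c, rfl⟩ := sigmaSkew_eq_sum_sigmaWedge hdet hA
  exact sum_mem fun k _ => sum_mem fun l _ => sigmaWedge_mem_sigmaSkewTransvection hdet _ _

theorem exists_of_mem_isotropyGroup (hdet : σ.det ≠ 0) {p : R4 n} {φ : Equiv.Perm (R4 n)}
    (hφ : φ ∈ (sigmaMetric σ).isotropyGroup p) :
    ∃ A ∈ sigmaSkew σ, ∀ x, φ x = x + A (x - p) := by
  have hp : φ p = p := hφ.2
  obtain ⟨b, hb, A, hA, h⟩ := mem_sigmaUnipotent_of_sigmaEnd_apply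
    (transvectionGroup_le_sigmaGroup hdet hφ.1) (x := p) (by rw [hp])
  refine ⟨A, hA, fun x => ?_⟩
  have hb : b = -A p := by
    rw [h, add_assoc, add_eq_left] at hp
    exact eq_neg_of_add_eq_zero_left hp
  rw [h, hb, map_sub]
  module

theorem mem_linearIsotropy_iff (hdet : σ.det ≠ 0) {p : R4 n} {L : R4 n →L[ℝ] R4 n} :
    L ∈ (sigmaMetric σ).linearIsotropy p ↔ L - 1 ∈ sigmaSkew σ := by
  have hderiv : ∀ {A : R4 n →L[ℝ] R4 n} {φ : Equiv.Perm (R4 n)},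
      (∀ x, φ x = x + A (x - p)) → fderiv ℝ φ p = 1 + A := by
    intro A φ h
    have h1 := (hasFDerivAt_id (𝕜 := ℝ) p).add
      (A.hasFDerivAt.comp p ((hasFDerivAt_id (𝕜 := ℝ) p).sub_const p))
    have h2 : HasFDerivAt φ _ p := h1.congr_of_eventuallyEq (.of_forall h)
    exact h2.fderiv
  constructor
  · rintro ⟨φ, hφ, rfl⟩
    obtain ⟨A, hA, h⟩ := exists_of_mem_isotropyGroup hdet hφ
    rwa [hderiv h, add_sub_cancel_left]
  · intro hL
    obtain ⟨-, φ, hφ, h⟩ := sigmaSkew_le_sigmaSkewTransvection hdet hL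
    -- `1 + A` fixes the origin; following it by translation by `-A p`, a vector of `ker J`, moves
    -- the fixed point to `p`.
    generalize hA : L - 1 = A at *
    have hψ : ∀ x, (Equiv.addRight (-A p) * φ) x = x + A (x - p) := fun x => by
      rw [Equiv.Perm.mul_apply, h, Equiv.coe_addRight, map_sub]
      module
    refine ⟨Equiv.addRight (-A p) * φ, ⟨mul_mem (addRight_mem_transvectionGroup
      (by simp [hL.1])) hφ, ?_⟩, ?_⟩
    · exact (hψ p).trans (by simp)
    · rw [hderiv hψ, ← hA, add_sub_cancel]

/-- The isotropy algebra of `sigmaMetric σ`. -/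
noncomputable def sigmaIsotropyAlgebra (hdet : σ.det ≠ 0) :
    LieSubalgebra ℝ (R4 n →L[ℝ] R4 n) where
  toSubmodule := sigmaSkew σ
  lie_mem' := fun {A B} hA hB => by
    change ⁅A, B⁆ ∈ sigmaSkew σ
    rw [LieRing.of_associative_ring_bracket, sigmaSkew_mul hdet hA hB, sigmaSkew_mul hdet hB hA,
      sub_zero]
    exact zero_mem _

theorem mem_sigmaIsotropyAlgebra {hdet : σ.det ≠ 0} {A : R4 n →L[ℝ] R4 n} :
    A ∈ sigmaIsotropyAlgebra hdet ↔ A ∈ sigmaSkew σ := Iff.rfl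

theorem isIsotropyAlgebra_sigmaIsotropyAlgebra (hdet : σ.det ≠ 0) (p : R4 n) :
    (sigmaMetric σ).IsIsotropyAlgebra p (sigmaIsotropyAlgebra hdet) := by
  intro A
  simp only [mem_linearIsotropy_iff hdet, mem_sigmaIsotropyAlgebra]
  refine ⟨fun hA t => ?_, fun h => ?_⟩
  · have htA := Submodule.smul_mem _ t hA
    rwa [exp_eq_one_add_of_mul_self_eq_zero (sigmaSkew_mul hdet htA htA), add_sub_cancel_left]
  -- `A` is the limit of `(exp (tA) - 1) / t`, and `sigmaSkew σ` is closed, being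
  -- finite-dimensional.
  · have hd := hasDerivAt_exp_smul_const (𝕂 := ℝ) A 0
    rw [zero_smul, NormedSpace.exp_zero, one_mul, hasDerivAt_iff_tendsto_slope] at hd
    refine (sigmaSkew σ).closed_of_finiteDimensional.mem_of_tendsto hd (.of_forall fun t => ?_)
    rw [slope_def_module, zero_smul, NormedSpace.exp_zero]
    exact Submodule.smul_mem _ _ (h t)

theorem isLieAbelian_sigmaIsotropyAlgebra (hdet : σ.det ≠ 0) :
    IsLieAbelian (sigmaIsotropyAlgebra hdet) := by
  refine ⟨fun A B => Subtype.ext ?_⟩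
  rw [LieSubalgebra.coe_bracket, LieRing.of_associative_ring_bracket, sigmaSkew_mul hdet A.2 B.2,
    sigmaSkew_mul hdet B.2 A.2, sub_zero]
  rfl

theorem isotropyGroup_mul_comm (hdet : σ.det ≠ 0) {p : R4 n} {φ ψ : Equiv.Perm (R4 n)}
    (hφ : φ ∈ (sigmaMetric σ).isotropyGroup p) (hψ : ψ ∈ (sigmaMetric σ).isotropyGroup p) :
    φ * ψ = ψ * φ := by
  have hmem : ∀ {χ}, χ ∈ (sigmaMetric σ).isotropyGroup p → χ ∈ sigmaUnipotent hdet := fun {χ} hχ =>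
    mem_sigmaUnipotent_of_sigmaEnd_apply (transvectionGroup_le_sigmaGroup hdet hχ.1) (x := p)
      (by rw [show χ p = p from hχ.2])
  exact commute_sigmaUnipotent (hmem hφ) (hmem hψ)

theorem isNilpotent_of_mem_sigmaSkew (hdet : σ.det ≠ 0) {A : R4 n →L[ℝ] R4 n}
    (hA : A ∈ sigmaSkew σ) : IsNilpotent A :=
  ⟨2, by rw [pow_two, sigmaSkew_mul hdet hA hA]⟩

end SigmaIsotropy

theorem proposition3p3 (n : ℕ) (hn : 1 ≤ n) (σ : Matrix (Fin n) (Fin n) ℝ)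
    (hσ : σ.IsSymm) (hdet : σ.det ≠ 0) :
    (sigmaMetric σ).IsSymmetricSpace ∧
    -- the transvection group is nilpotent, of class exactly three
    (∃ _ : Group.IsNilpotent (sigmaMetric σ).transvectionGroup,
      Group.nilpotencyClass (sigmaMetric σ).transvectionGroup = 3) ∧
    -- it is solvable, of derived length exactly two
    (derivedSeries (sigmaMetric σ).transvectionGroup 2 = ⊥ ∧
      derivedSeries (sigmaMetric σ).transvectionGroup 1 ≠ ⊥) ∧
    ∀ p : R4 n,
      -- the isotropy group at p is abelian
      (∀ φ ∈ (sigmaMetric σ).isotropyGroup p, ∀ ψ ∈ (sigmaMetric σ).isotropyGroup p,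
        φ * ψ = ψ * φ) ∧
      -- it acts on the tangent space at p by unipotent endomorphisms
      (∀ A ∈ (sigmaMetric σ).linearIsotropy p, IsNilpotent (A - 1)) ∧
      -- the isotropy algebra is abelian, consists of nilpotent endomorphisms,
      -- and has dimension n(2n-1)
      ∃ 𝔥 : LieSubalgebra ℝ (R4 n →L[ℝ] R4 n),
        (sigmaMetric σ).IsIsotropyAlgebra p 𝔥 ∧ IsLieAbelian 𝔥 ∧
        (∀ A ∈ 𝔥, IsNilpotent A) ∧
        Module.finrank ℝ 𝔥 = n * (2 * n - 1) :=
  have hnil := isNilpotent_transvectionGroup hdet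
  ⟨isSymmetricSpace_sigmaMetric σ, ⟨hnil, nilpotencyClass_transvectionGroup hn hdet⟩,
    ⟨derivedSeries_two_transvectionGroup hdet, derivedSeries_one_transvectionGroup_ne_bot hn hdet⟩,
    fun p => ⟨fun _ hφ _ hψ => isotropyGroup_mul_comm hdet hφ hψ,
      fun _ hA => isNilpotent_of_mem_sigmaSkew hdet ((mem_linearIsotropy_iff hdet).1 hA),
      sigmaIsotropyAlgebra hdet, isIsotropyAlgebra_sigmaIsotropyAlgebra hdet p,
      isLieAbelian_sigmaIsotropyAlgebra hdet, fun _ hA => isNilpotent_of_mem_sigmaSkew hdet hA,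
      finrank_sigmaSkew hdet⟩⟩
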